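/- We work with compactly generated topologies: products are taken in the category of compactly generated spaces (the k-ification of the product topology). For a space $X$ with base point $x_0$ let $X^n$ be the $n$-fold Cartesian power, and for $k\ge 1$ let $X^{(k)}$ be the $k$-fold smash power, i.e. the quotient of $X^k$ that collapses the points with some coordinate equal to $x_0$ to one point; write $x_1\wedge\dots\wedge x_k$ for the image of $(x_1,\dots,x_k)$. For a pointed space $(Y,y_0)$ let $J(Y)$ be the James construction: the monoid of words in the points of $Y$ subject to the single relation $y_0=1$, with the quotient topology from $\bigsqcup_{m\ge 0}Y^m$; let $E\colon Y\to J(Y)$ be the canonical inclusion. The set $[X^n,J(X^{(k)})]$ of pointed homotopy classes of pointed maps is a monoid under pointwise multiplication of representatives. For integers $n\ge 0$, $k\ge 1$ let $K_n(k)$ be the group generated by the words $\{x_{i_1}|\cdots|x_{i_k}\}$ with $1\le i_1,\dots,i_k\le n$, subject to the following relations, in which $[x,y]=x^{-1}y^{-1}xy$ and $[[a_1,\dots,a_l]=[\cdots[[a_1,a_2],a_3],\cdots,a_l]$ (equal to $a_1$ if $l=1$): 1. $\{x_{i_1}|\cdots|x_{i_k}\}=1$ if $i_s=i_t$ for some $s<t$;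 2. $[[\{x_{i_1}|\cdots|x_{i_k}\},\{x_{i_{k+1}}|\cdots|x_{i_{2k}}\},\dots,\{x_{i_{(l-1)k+1}}|\cdots|x_{i_{lk}}\}]=1$ if $i_s=i_t$ for some $1\le s<t\le kl$; 3. $[[w_1^{n_1},\dots,w_l^{n_l}]=[[w_1,\dots,w_l]^{n_1\cdots n_l}$ for all generators $w_1,\dots,w_l$ and all integers $n_1,\dots,n_l$. **Proposition.** Let $X$ be a compactly generated path connected space with a non-degenerate base point $x_0$ (that is, $(X,\{x_0\})$ is an NDR pair), and suppose that $X$ has weak LS-category less than $2$, i.e. the reduced diagonal $X\to X^{(2)}$, $x\mapsto x\wedge x$, is pointed null homotopic. Let $n\ge 0$ and $k\ge 1$. (a) If $X$ has the homotopy type of a CW complex, then the monoid $[X^n,J(X^{(k)})]$ is a group. (b) Whenever $[X^n,J(X^{(k)})]$ is a group, there is a group homomorphism $$e_X\colon K_n(k)\longrightarrow [X^n,J(X^{(k)})]$$ that sends each generator $\{x_{i_1}|\cdots|x_{i_k}\}$ to the homotopy class of the composite $$X^n\xrightarrow{\;p_{i_1\cdots i_k}\;}X^{(k)}\xrightarrow{\;E\;}J(X^{(k)}),\qquad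 p_{i_1\cdots i_k}(x_1,\dots,x_n)=x_{i_1}\wedge\cdots\wedge x_{i_k}.$$ -/

import Mathlib

open Topology
open scoped unitInterval

universe u

namespace CohenJames

/-! ### Compactly generated products, smash powers, the James construction -/

/-- The family of all compact Hausdorff spaces (in the universe `u`). -/
abbrev compHausFamily : CompHaus.{u} → Type u := fun S => S

/-- `KSpace Z` is the set `Z` with the compactly generated topology associated with the given one
(the k-ification of `Z`): the finest topology for which every map from a compact Hausdorff space
that is continuous for the given topology stays continuous. -/
abbrev KSpace (Z : Type u) [TopologicalSpace Z] : Type u :=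
  WithGeneratedByTopology compHausFamily.{u} Z

/-- The `n`-fold Cartesian power of `X` in the category of compactly generated spaces. -/
abbrev KPow (X : Type u) [TopologicalSpace X] (n : ℕ) : Type u :=
  KSpace (Fin n → X)

/-- The point of the Cartesian power with the given coordinates. -/
def KPow.mk {X : Type u} [TopologicalSpace X] {n : ℕ} (v : Fin n → X) : KPow X n :=
  WithGeneratedByTopology.equiv.symm v

/-- The coordinates of a point of the Cartesian power. -/
def KPow.coord {X : Type u} [TopologicalSpace X] {n : ℕ} (v : KPow X n) : Fin n → X :=
  WithGeneratedByTopology.equiv v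

/-- The equivalence relation on `X^k` that collapses the fat wedge (the points with at least one
coordinate equal to the base point) to a point. -/
def smashSetoid {X : Type u} [TopologicalSpace X] (x₀ : X) (k : ℕ) : Setoid (KPow X k) where
  r v w := v = w ∨ ((∃ i, v.coord i = x₀) ∧ ∃ i, w.coord i = x₀)
  iseqv :=
    { refl := fun _ => Or.inl rfl
      symm := by
        rintro v w (h | ⟨h, h'⟩)
        · exact Or.inl h.symm
        · exact Or.inr ⟨h', h⟩
      trans := by
        rintro a b c (rfl | ⟨h, h'⟩) (rfl | ⟨h₁, h₂⟩)
        · exact Or.inl rfl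
        · exact Or.inr ⟨h₁, h₂⟩
        · exact Or.inr ⟨h, h'⟩
        · exact Or.inr ⟨h, h₂⟩ }

/-- The `k`-fold smash power `X^(k)` (for `k ≥ 1`) of the pointed space `(X, x₀)`, with the quotient
topology from the compactly generated power `X^k`. -/
abbrev Smash {X : Type u} [TopologicalSpace X] (x₀ : X) (k : ℕ) : Type u :=
  Quotient (smashSetoid x₀ k)

/-- The point `x_1 ∧ ... ∧ x_k` of the smash power. -/
def Smash.mk {X : Type u} [TopologicalSpace X] (x₀ : X) {k : ℕ} (v : Fin k → X) : Smash x₀ k :=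
  Quotient.mk (smashSetoid x₀ k) (KPow.mk v)

/-- The base point of the smash power. -/
def Smash.base {X : Type u} [TopologicalSpace X] (x₀ : X) (k : ℕ) : Smash x₀ k :=
  Smash.mk x₀ fun _ => x₀

/-- The congruence on the free monoid on `Y` generated by `y₀ = 1`. -/
def jamesCon {Y : Type u} (y₀ : Y) : Con (FreeMonoid Y) :=
  conGen fun a b => a = FreeMonoid.of y₀ ∧ b = 1

/-- The James construction `J(Y)` on the pointed space `(Y, y₀)`: words in the points of `Y`, where
occurrences of the letter `y₀` may be deleted or inserted. -/
def James {Y : Type u} (y₀ : Y) : Type u :=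
  (jamesCon y₀).Quotient

instance {Y : Type u} (y₀ : Y) : Monoid (James y₀) :=
  inferInstanceAs (Monoid (jamesCon y₀).Quotient)

/-- The word `y_1 ... y_m` as a point of `J(Y)`. -/
def James.word {Y : Type u} (y₀ : Y) (l : List Y) : James y₀ :=
  (jamesCon y₀).toQuotient (FreeMonoid.ofList l)

/-- The projection from the disjoint union of the powers `Y^m` onto `J(Y)`. -/
def James.proj {Y : Type u} [TopologicalSpace Y] (y₀ : Y) (s : Σ m : ℕ, KPow Y m) : James y₀ :=
  James.word y₀ (List.ofFn s.2.coord)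

/-- `J(Y)` has the quotient topology from the disjoint union of the compactly generated
powers `Y^m`. -/
instance {Y : Type u} [TopologicalSpace Y] (y₀ : Y) : TopologicalSpace (James y₀) :=
  TopologicalSpace.coinduced (James.proj y₀) inferInstance

/-! ### Continuity facts -/

instance isGeneratedBy_of_compactlyGenerated (X : Type u) [TopologicalSpace X]
    [CompactlyGeneratedSpace X] : IsGeneratedBy compHausFamily.{u} X where
  continuous_equiv_symm := by
    refine continuous_from_uCompactlyGeneratedSpace _ fun S g => ?_
    exact (IsGeneratedBy.equiv_symm_comp_continuous_iff (X := compHausFamily.{u}) (g : S → X)).2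
      g.continuous

theorem KPow.continuous_coord {X : Type u} [TopologicalSpace X] {n : ℕ} :
    Continuous (KPow.coord : KPow X n → Fin n → X) :=
  WithGeneratedByTopology.continuous_equiv

theorem KPow.continuous_mk {W X : Type u} [TopologicalSpace W] [TopologicalSpace X]
    [IsGeneratedBy compHausFamily.{u} W] {n : ℕ} {f : W → Fin n → X} (hf : Continuous f) :
    Continuous fun w => KPow.mk (f w) :=
  (IsGeneratedBy.equiv_symm_comp_continuous_iff (X := compHausFamily.{u}) f).2 hf

theorem Smash.continuous_mk {W X : Type u} [TopologicalSpace W] [TopologicalSpace X]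
    [IsGeneratedBy compHausFamily.{u} W] (x₀ : X) {k : ℕ} {f : W → Fin k → X}
    (hf : Continuous f) : Continuous fun w => Smash.mk x₀ (f w) :=
  continuous_quotient_mk'.comp (KPow.continuous_mk hf)

theorem Smash.mk_eq_base {X : Type u} [TopologicalSpace X] (x₀ : X) {k : ℕ} (v : Fin k → X)
    (h : ∃ i, v i = x₀) : Smash.mk x₀ v = Smash.base x₀ k :=
  Quotient.sound (Or.inr ⟨h, h.imp fun _ _ => rfl⟩)

theorem James.continuous_proj {Y : Type u} [TopologicalSpace Y] (y₀ : Y) :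
    Continuous (James.proj y₀) :=
  continuous_coinduced_rng

theorem James.isQuotientMap_proj {Y : Type u} [TopologicalSpace Y] (y₀ : Y) :
    IsQuotientMap (James.proj y₀) where
  surjective a := by
    obtain ⟨l, rfl⟩ := Quotient.exists_rep a
    exact ⟨⟨l.toList.length, KPow.mk l.toList.get⟩, by
      show James.word y₀ (List.ofFn l.toList.get) = _
      rw [List.ofFn_get]; rfl⟩
  eq_coinduced := rfl

theorem James.word_append {Y : Type u} (y₀ : Y) (l l' : List Y) :
    James.word y₀ (l ++ l') = James.word y₀ l * James.word y₀ l' :=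
  rfl

theorem James.word_base {Y : Type u} (y₀ : Y) : James.word y₀ [y₀] = 1 :=
  (Con.eq _).2 (ConGen.Rel.of _ _ ⟨rfl, rfl⟩)

/-- A map on `Z × K`, with `Z` compactly generated and `K` locally compact, is continuous as soon as
it is continuous after composition with every test map into `Z`. -/
theorem continuous_prod_of_test {Z : Type u} {K T : Type*} [TopologicalSpace Z]
    [TopologicalSpace K] [TopologicalSpace T] [IsGeneratedBy compHausFamily.{u} Z]
    [LocallyCompactSpace K] (F : Z × K → T)
    (h : ∀ (L : CompHaus.{u}) (a : C(L, Z)), Continuous fun p : L × K => F (a p.1, p.2)) :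
    Continuous F := by
  have h₁ : ∀ z, Continuous fun x => F (z, x) := fun z =>
    (h (CompHaus.of PUnit) (ContinuousMap.const _ z)).comp
      (Continuous.prodMk (continuous_const (y := PUnit.unit)) continuous_id)
  let G : Z → C(K, T) := fun z => ⟨fun x => F (z, x), h₁ z⟩
  have hG : Continuous G := by
    rw [IsGeneratedBy.continuous_iff compHausFamily.{u}]
    intro L a
    exact ContinuousMap.continuous_of_continuous_uncurry _ (h L a)
  exact ContinuousMap.continuous_uncurry_of_continuous ⟨G, hG⟩

/-- A monoid whose multiplication is continuous for the compactly generated product topology. -/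
class ContinuousKMul (M : Type u) [TopologicalSpace M] [Monoid M] : Prop where
  continuous_mul_test : ∀ (K : Type u) [TopologicalSpace K] [CompactSpace K] [T2Space K]
    (f g : K → M), Continuous f → Continuous g → Continuous fun x => f x * g x

theorem James.continuous_mul_aux {Y : Type u} [TopologicalSpace Y] (y₀ : Y) {L L' : Type u}
    [TopologicalSpace L] [CompactSpace L] [T2Space L]
    [TopologicalSpace L'] [CompactSpace L'] [T2Space L'] (m m' : ℕ) (a : L → KPow Y m)
    (b : L' → KPow Y m') (ha : Continuous a) (hb : Continuous b) :
    Continuous fun p : L × L' => James.proj y₀ ⟨m, a p.1⟩ * James.proj y₀ ⟨m', b p.2⟩ := by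
  have key : (fun p : L × L' => James.proj y₀ ⟨m, a p.1⟩ * James.proj y₀ ⟨m', b p.2⟩) =
      fun p : L × L' => James.proj y₀
        ⟨m + m', KPow.mk (Fin.append (a p.1).coord (b p.2).coord)⟩ := by
    funext p
    show James.word y₀ _ * James.word y₀ _ =
      James.word y₀ (List.ofFn (Fin.append (a p.1).coord (b p.2).coord))
    rw [List.ofFn_fin_append, James.word_append]
  rw [key]
  refine (James.continuous_proj y₀).comp (continuous_sigmaMk.comp (KPow.continuous_mk ?_))
  refine continuous_pi fun i => ?_
  refine Fin.addCases (fun j => ?_) (fun j => ?_) i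
  · simp only [Fin.append_left]
    exact (continuous_apply j).comp (KPow.continuous_coord.comp (ha.comp continuous_fst))
  · simp only [Fin.append_right]
    exact (continuous_apply j).comp (KPow.continuous_coord.comp (hb.comp continuous_snd))

theorem James.continuous_prod_of_test {Y : Type u} [TopologicalSpace Y] (y₀ : Y) {K T : Type*}
    [TopologicalSpace K] [LocallyCompactSpace K] [TopologicalSpace T] (F : James y₀ × K → T)
    (h : ∀ (m : ℕ) (L : CompHaus.{u}) (a : C(L, KPow Y m)),
      Continuous fun p : L × K => F (James.proj y₀ ⟨m, a p.1⟩, p.2)) :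
    Continuous F := by
  refine (James.isQuotientMap_proj y₀).continuous_lift_prod_left ?_
  have h₁ : Continuous fun q : Σ m : ℕ, KPow Y m × K => F (James.proj y₀ ⟨q.1, q.2.1⟩, q.2.2) :=
    continuous_sigma fun m => CohenJames.continuous_prod_of_test
      (fun p : KPow Y m × K => F (James.proj y₀ ⟨m, p.1⟩, p.2)) (h m)
  exact h₁.comp (Homeomorph.sigmaProdDistrib (X := fun m => KPow Y m) (Y := K)).continuous

theorem James.continuous_proj_mul {Y : Type u} [TopologicalSpace Y] (y₀ : Y) {L : Type u}
    [TopologicalSpace L] [CompactSpace L] [T2Space L] (m : ℕ) (a : L → KPow Y m)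
    (ha : Continuous a) :
    Continuous fun p : James y₀ × L => James.proj y₀ ⟨m, a p.2⟩ * p.1 := by
  refine James.continuous_prod_of_test y₀
    (fun p : James y₀ × L => James.proj y₀ ⟨m, a p.2⟩ * p.1) fun m' L' b => ?_
  have h := James.continuous_mul_aux y₀ m m' a b ha b.continuous
  have hs : Continuous fun p : L' × L => (p.2, p.1) := continuous_swap
  have h' := Continuous.comp h hs
  exact h'

instance {Y : Type u} [TopologicalSpace Y] (y₀ : Y) : ContinuousKMul (James y₀) where
  continuous_mul_test K _ _ _ f g hf hg := by
    have step : Continuous fun p : James y₀ × K => p.1 * g p.2 := by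
      refine James.continuous_prod_of_test y₀ (fun p : James y₀ × K => p.1 * g p.2)
        fun m L a => ?_
      have h := James.continuous_proj_mul y₀ m a a.continuous
      have hs : Continuous fun p : L × K => (g p.2, p.1) :=
        (hg.comp continuous_snd).prodMk continuous_fst
      exact Continuous.comp h hs
    have hf' : Continuous fun x => (f x, x) := hf.prodMk continuous_id
    exact Continuous.comp step hf'

theorem continuous_kmul {W M : Type u} [TopologicalSpace W] [IsGeneratedBy compHausFamily.{u} W]
    [TopologicalSpace M] [Monoid M] [ContinuousKMul M] {f g : W → M} (hf : Continuous f)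
    (hg : Continuous g) : Continuous fun w => f w * g w := by
  rw [IsGeneratedBy.continuous_iff compHausFamily.{u}]
  intro L a
  exact ContinuousKMul.continuous_mul_test L _ _ (hf.comp a.continuous) (hg.comp a.continuous)

theorem continuous_kmul_homotopy {W M : Type u} [TopologicalSpace W]
    [IsGeneratedBy compHausFamily.{u} W] [TopologicalSpace M] [Monoid M] [ContinuousKMul M]
    {F G : I × W → M} (hF : Continuous F) (hG : Continuous G) :
    Continuous fun p => F p * G p := by
  have h : Continuous fun p : W × I => F (p.2, p.1) * G (p.2, p.1) := by
    refine continuous_prod_of_test _ fun L a => ?_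
    exact ContinuousKMul.continuous_mul_test (L × I) (fun p => F (p.2, a p.1))
      (fun p => G (p.2, a p.1)) (by fun_prop) (by fun_prop)
  exact h.comp continuous_swap

/-! ### Pointed homotopy classes of maps into a monoid -/

/-- Pointed maps from `(W, w₀)` to `M`, whose base point is the unit. -/
abbrev PointedMap {W : Type u} [TopologicalSpace W] (w₀ : W) (M : Type u) [TopologicalSpace M]
    [Monoid M] : Type u :=
  {f : C(W, M) // f w₀ = 1}

/-- Pointed homotopy. -/
def pointedHomotopySetoid {W : Type u} [TopologicalSpace W] (w₀ : W) (M : Type u)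
    [TopologicalSpace M] [Monoid M] : Setoid (PointedMap w₀ M) where
  r f g := f.1.HomotopicRel g.1 {w₀}
  iseqv :=
    { refl := fun f => ContinuousMap.HomotopicRel.refl f.1
      symm := fun h => h.symm
      trans := fun h h' => h.trans h' }

/-- The set `[W, M]` of pointed homotopy classes of pointed maps. -/
def PointedClasses {W : Type u} [TopologicalSpace W] (w₀ : W) (M : Type u) [TopologicalSpace M]
    [Monoid M] : Type u :=
  Quotient (pointedHomotopySetoid w₀ M)

section Classes

variable {W : Type u} [TopologicalSpace W] [IsGeneratedBy compHausFamily.{u} W] {w₀ : W}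
  {M : Type u} [TopologicalSpace M] [Monoid M] [ContinuousKMul M]

/-- The pointwise product of pointed maps. -/
instance : Mul (PointedMap w₀ M) where
  mul f g := ⟨⟨fun w => f.1 w * g.1 w, continuous_kmul f.1.continuous g.1.continuous⟩, by
    show f.1 w₀ * g.1 w₀ = 1
    rw [f.2, g.2, one_mul]⟩

/-- The constant map. -/
instance : One (PointedMap w₀ M) where
  one := ⟨ContinuousMap.const W 1, rfl⟩

theorem pointedMap_mul_homotopic {f f' g g' : PointedMap w₀ M}
    (h : f.1.HomotopicRel f'.1 {w₀}) (h' : g.1.HomotopicRel g'.1 {w₀}) :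
    (f * g).1.HomotopicRel (f' * g').1 {w₀} := by
  obtain ⟨F⟩ := h
  obtain ⟨G⟩ := h'
  refine ⟨⟨⟨⟨fun p => F p * G p, continuous_kmul_homotopy F.continuous G.continuous⟩,
    fun w => ?_, fun w => ?_⟩, fun t w hw => ?_⟩⟩
  · show F (0, w) * G (0, w) = f.1 w * g.1 w
    rw [F.apply_zero, G.apply_zero]
  · show F (1, w) * G (1, w) = f'.1 w * g'.1 w
    rw [F.apply_one, G.apply_one]
  · show F (t, w) * G (t, w) = f.1 w * g.1 w
    rw [F.eq_fst t hw, G.eq_fst t hw]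

/-- `[W, M]` is a monoid under pointwise multiplication of representatives. -/
instance : Monoid (PointedClasses w₀ M) where
  mul := Quotient.map₂ (· * ·) fun _ _ h _ _ h' => pointedMap_mul_homotopic h h'
  one := Quotient.mk _ 1
  mul_assoc := by
    rintro ⟨f⟩ ⟨g⟩ ⟨h⟩
    exact congrArg (Quotient.mk _)
      (Subtype.ext (ContinuousMap.ext fun w => mul_assoc (f.1 w) (g.1 w) (h.1 w)))
  one_mul := by
    rintro ⟨f⟩
    exact congrArg (Quotient.mk _)
      (Subtype.ext (ContinuousMap.ext fun w => one_mul (f.1 w)))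
  mul_one := by
    rintro ⟨f⟩
    exact congrArg (Quotient.mk _)
      (Subtype.ext (ContinuousMap.ext fun w => mul_one (f.1 w)))

end Classes

/-! ### Hypotheses on the space -/

/-- `x₀` is a non-degenerate base point: `(X, {x₀})` is an NDR pair. -/
def NondegenerateBasePoint {X : Type u} [TopologicalSpace X] (x₀ : X) : Prop :=
  ∃ (d : C(X, I)) (h : C(I × X, X)), (∀ x, d x = 0 ↔ x = x₀) ∧ (∀ x, h (0, x) = x) ∧
    (∀ t, h (t, x₀) = x₀) ∧ ∀ x, d x < 1 → h (1, x) = x₀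

/-- The reduced diagonal `X → X^(k)`, `x ↦ x ∧ ... ∧ x`. -/
def reducedDiagonal {X : Type u} [TopologicalSpace X] [CompactlyGeneratedSpace X] (x₀ : X)
    (k : ℕ) : C(X, Smash x₀ k) :=
  ⟨fun x => Smash.mk x₀ fun _ => x, Smash.continuous_mk x₀ (continuous_pi fun _ => continuous_id)⟩

/-- `X` has weak LS-category less than `k`: the `k`-fold reduced diagonal is null homotopic
(as a pointed map). -/
def WeakLSCatLT {X : Type u} [TopologicalSpace X] [CompactlyGeneratedSpace X] (x₀ : X)
    (k : ℕ) : Prop :=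
  (reducedDiagonal x₀ k).HomotopicRel (ContinuousMap.const X (Smash.base x₀ k)) {x₀}

/-- `X` has the homotopy type of a CW complex. -/
def HasCWHomotopyType (X : Type u) [TopologicalSpace X] : Prop :=
  ∃ (K : Type u) (_ : TopologicalSpace K) (_ : T2Space K),
    Nonempty (CWComplex (Set.univ : Set K)) ∧ Nonempty (ContinuousMap.HomotopyEquiv X K)

/-! ### The homotopy classes `{x_{i_1}|...|x_{i_k}}` -/

/-- The canonical inclusion `E : Y → J(Y)`. -/
def James.incl {Y : Type u} [TopologicalSpace Y] [IsGeneratedBy compHausFamily.{u} Y] (y₀ : Y) :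
    C(Y, James y₀) :=
  ⟨fun y => James.word y₀ [y], by
    have h : Continuous fun y : Y => (⟨1, KPow.mk fun _ => y⟩ : Σ m : ℕ, KPow Y m) :=
      continuous_sigmaMk.comp (KPow.continuous_mk (continuous_pi fun _ => continuous_id))
    exact (James.continuous_proj y₀).comp h⟩

/-- The map `X^n → X^(k)`, `(x_1, ..., x_n) ↦ x_{i_1} ∧ ... ∧ x_{i_k}`. -/
def smashProj {X : Type u} [TopologicalSpace X] (x₀ : X) {n k : ℕ} (i : Fin k → Fin n) :
    C(KPow X n, Smash x₀ k) :=
  ⟨fun v => Smash.mk x₀ fun j => v.coord (i j), Smash.continuous_mk x₀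
    (continuous_pi fun j => (continuous_apply (i j)).comp KPow.continuous_coord)⟩

/-- `[X^n, J(X^(k))]`, with the base point `(x₀, ..., x₀)` of `X^n`. -/
abbrev CohenTarget {X : Type u} [TopologicalSpace X] (x₀ : X) (n k : ℕ) : Type u :=
  PointedClasses (KPow.mk fun _ : Fin n => x₀) (James (Smash.base x₀ k))

/-- The class of the composite `X^n → X^(k) → J(X^(k))`. -/
def wordClass {X : Type u} [TopologicalSpace X] (x₀ : X) {n k : ℕ} (i : Fin k → Fin n) :
    CohenTarget x₀ n k :=
  Quotient.mk _ ⟨(James.incl (Smash.base x₀ k)).comp (smashProj x₀ i),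
    James.word_base (Smash.base x₀ k)⟩

/-! ### The combinatorial group `K_n(k)` -/

/-- The commutator `[x, y] = x⁻¹ y⁻¹ x y`. -/
def comm {G : Type*} [Group G] (x y : G) : G := x⁻¹ * y⁻¹ * x * y

/-- The iterated commutator `[...[[a_1, a_2], a_3], ..., a_l]`; equal to `a_1` if `l = 1`. -/
def iteratedComm {G : Type*} [Group G] : List G → G
  | [] => 1
  | a :: l => l.foldl comm a

/-- The relators of `K_n(k)`, in the free group on the words `{x_{i_1}|...|x_{i_k}}`. -/
inductive CohenRelator (n k : ℕ) : FreeGroup (Fin k → Fin n) → Prop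
  /-- A generator with a repeated index is trivial. -/
  | word (i : Fin k → Fin n) (hi : ¬ Function.Injective i) : CohenRelator n k (FreeGroup.of i)
  /-- An iterated commutator of generators is trivial if some index occurs twice in it. -/
  | comm (L : List (Fin k → Fin n)) (hL : ¬ (L.flatMap fun i => List.ofFn i).Nodup) :
      CohenRelator n k (iteratedComm (L.map FreeGroup.of))
  /-- Exponents may be taken out of iterated commutators of generators. -/
  | pow (L : List ((Fin k → Fin n) × ℤ)) :
      CohenRelator n k
        (iteratedComm (L.map fun p => FreeGroup.of p.1 ^ p.2) *
          (iteratedComm (L.map fun p => FreeGroup.of p.1) ^ (L.map fun p => p.2).prod)⁻¹)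

/-- The group `K_n(k)`. -/
abbrev CohenGroup (n k : ℕ) : Type :=
  PresentedGroup {r : FreeGroup (Fin k → Fin n) | CohenRelator n k r}

end CohenJames

/-!
(a) By the adjunction between products and mapping spaces, inverting maps on `X ^ n` up to homotopy
reduces to inverting maps on `X`, and so on a CW complex, where an inverse and the null homotopy of
its product with the given map are built together, cell by cell. Since the base point is
non-degenerate, the homotopies can then be made pointed.

(b) The reduced diagonal is null homotopic, so a map on `X ^ n` that is trivial as soon as one of
two given coordinates is the base point becomes null homotopic on the diagonal of these coordinates.
A generator or an iterated commutator with a repeated index is the restriction to such a diagonal of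
one in which the two occurrences are separated, and so it is trivial. The relations between
powers follow, as iterated commutators with a repeated entry vanish.
-/

namespace CohenJames

@[elab_as_elim]
theorem list_append_singleton_induction {α : Type*} {P : List α → Prop} (nil : P [])
    (singleton : ∀ x, P [x]) (append_singleton : ∀ l x, l ≠ [] → P l → P (l ++ [x])) (l : List α) :
    P l := by
  induction l using List.reverseRecOn with
  | nil => exact nil
  | append_singleton l x ih =>
    rcases eq_or_ne l [] with rfl | hl
    · exact singleton x
    · exact append_singleton l x hl ih

section Commutators

open scoped commutatorElement

variable {G H : Type*} [Group G] [Group H]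

theorem comm_eq_commutatorElement (x y : G) : comm x y = ⁅x⁻¹, y⁻¹⁆ := by
  simp only [comm, commutatorElement_def, inv_inv]

theorem map_comm (f : G →* H) (x y : G) : f (comm x y) = comm (f x) (f y) := by
  simp only [comm, map_mul, map_inv]

theorem comm_inv (x y : G) : (comm x y)⁻¹ = comm y x := by
  simp only [comm_eq_commutatorElement, commutatorElement_inv]

theorem comm_eq_one_iff_commute {x y : G} : comm x y = 1 ↔ Commute x y := by
  rw [comm_eq_commutatorElement, commutatorElement_eq_one_iff_commute, Commute.inv_inv_iff]

theorem comm_zpow_left {x y : G} (h : Commute (comm x y) x) (a : ℤ) :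
    comm (x ^ a) y = comm x y ^ a := by
  have conj_x : y⁻¹ * x * y⁻¹⁻¹ = x * comm x y := by simp only [comm]; group
  calc comm (x ^ a) y = (x ^ a)⁻¹ * (y⁻¹ * x ^ a * y⁻¹⁻¹) := by simp only [comm]; group
    _ = (x ^ a)⁻¹ * (x ^ a * comm x y ^ a) := by rw [← conj_zpow, conj_x, h.symm.mul_zpow]
    _ = comm x y ^ a := inv_mul_cancel_left _ _

theorem comm_zpow_right {x y : G} (h : Commute (comm x y) y) (b : ℤ) :
    comm x (y ^ b) = comm x y ^ b := by
  have h' : Commute (comm y x) y := comm_inv x y ▸ h.inv_left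
  rw [← comm_inv, comm_zpow_left h', ← comm_inv x y, inv_zpow, inv_inv]

theorem comm_zpow_zpow {x y : G} (hx : Commute (comm x y) x) (hy : Commute (comm x y) y)
    (a b : ℤ) : comm (x ^ a) (y ^ b) = comm x y ^ (a * b) := by
  rw [zpow_mul, ← comm_zpow_left hx, comm_zpow_right]
  exact comm_zpow_left hx a ▸ hy.zpow_left a

theorem iteratedComm_append_singleton {l : List G} (hl : l ≠ []) (x : G) :
    iteratedComm (l ++ [x]) = comm (iteratedComm l) x := by
  cases l with
  | nil => exact absurd rfl hl
  | cons a l => simp only [iteratedComm, List.cons_append, List.foldl_append, List.foldl_cons,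
      List.foldl_nil]

theorem map_iteratedComm (f : G →* H) (l : List G) :
    f (iteratedComm l) = iteratedComm (l.map f) := by
  induction l using list_append_singleton_induction with
  | nil => exact map_one f
  | singleton x => rfl
  | append_singleton l x hl ih =>
    rw [List.map_append, List.map_singleton, iteratedComm_append_singleton hl,
      iteratedComm_append_singleton (mt List.map_eq_nil_iff.1 hl), map_comm, ih]

theorem iteratedComm_eq_one {l : List G} (h : (1 : G) ∈ l) : iteratedComm l = 1 := by
  induction l using list_append_singleton_induction with
  | nil => rfl
  | singleton x => exact (List.mem_singleton.1 h).symm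
  | append_singleton l x hl ih =>
    rw [iteratedComm_append_singleton hl, comm_eq_one_iff_commute]
    rcases List.mem_append.1 h with h | h
    · exact ih h ▸ Commute.one_left x
    · exact List.mem_singleton.1 h ▸ Commute.one_right _

theorem commute_iteratedComm {v : G} {l : List G} (h : ∀ x ∈ l, Commute v x) :
    Commute v (iteratedComm l) := by
  have key : iteratedComm l ∈ Subgroup.centralizer {v} := by
    induction l using list_append_singleton_induction with
    | nil => exact one_mem _
    | singleton x => exact Subgroup.mem_centralizer_singleton_iff.2 (h x (by simp)).eq.symm
    | append_singleton l x hl ih =>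
      have hx : x ∈ Subgroup.centralizer {v} :=
        Subgroup.mem_centralizer_singleton_iff.2 (h x (by simp)).eq.symm
      have hl' := ih fun y hy => h y (List.mem_append_left _ hy)
      rw [iteratedComm_append_singleton hl]
      exact mul_mem (mul_mem (mul_mem (inv_mem hl') (inv_mem hx)) hl') hx
  exact (Subgroup.mem_centralizer_singleton_iff.1 key).symm

theorem iteratedComm_zpow {ι : Type*} (u : ι → G)
    (hu : ∀ l : List ι, ¬ l.Nodup → iteratedComm (l.map u) = 1) (L : List (ι × ℤ)) :
    iteratedComm (L.map fun p => u p.1 ^ p.2) =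
      iteratedComm (L.map fun p => u p.1) ^ (L.map fun p => p.2).prod := by
  induction L using list_append_singleton_induction with
  | nil => simp [iteratedComm]
  | singleton p => simp [iteratedComm]
  | append_singleton L p hL ih =>
    have map_ne_nil : ∀ v : ι × ℤ → G, L.map v ≠ [] := fun v => mt List.map_eq_nil_iff.1 hL
    -- Appending an entry that already occurs gives a trivial commutator.
    have commute_entry : ∀ q ∈ L ++ [p],
        Commute (comm (iteratedComm (L.map fun p => u p.1)) (u p.1)) (u q.1) := by
      intro q hq
      have nodup : ¬ ((L ++ [p]).map Prod.fst ++ [q.1]).Nodup := fun h =>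
        (List.nodup_append.1 h).2.2 _ (List.mem_map_of_mem hq) _ (List.mem_singleton_self _) rfl
      have := hu _ nodup
      rwa [List.map_append, List.map_map, List.map_singleton,
        iteratedComm_append_singleton (by simp), comm_eq_one_iff_commute, List.map_append,
        List.map_singleton, iteratedComm_append_singleton (map_ne_nil _)] at this
    have commute_comm : Commute (comm (iteratedComm (L.map fun p => u p.1)) (u p.1))
        (iteratedComm (L.map fun p => u p.1)) :=
      commute_iteratedComm <| List.forall_mem_map.2 fun q hq =>
        commute_entry q (List.mem_append_left _ hq)
    simp only [List.map_append, List.map_singleton, List.prod_append, List.prod_singleton,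
      iteratedComm_append_singleton (map_ne_nil _), ih]
    exact comm_zpow_zpow commute_comm (commute_entry p (by simp)) _ _

end Commutators

theorem exists_append_of_not_pairwise {α : Type*} {R : α → α → Prop} {l : List α}
    (h : ¬ l.Pairwise R) : ∃ l₁ l₂, l = l₁ ++ l₂ ∧ ∃ x ∈ l₁, ∃ y ∈ l₂, ¬ R x y := by
  rw [List.pairwise_iff_getElem] at h
  push Not at h
  obtain ⟨i, j, hi, hj, hij, hR⟩ := h
  exact ⟨l.take j, l.drop j, (l.take_append_drop j).symm, _, List.mem_take_iff_getElem.2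
    ⟨i, by omega, rfl⟩, _, List.mem_drop_iff_getElem.2 ⟨0, by omega, rfl⟩, hR⟩

/-- A retraction `r` of `W` onto a subspace, together with a deformation `h` of `W`, fixed on that
subspace, which has retracted the neighbourhood `d < 1` of the subspace when it ends. Unlike in an
NDR pair, `d` may vanish outside the subspace. -/
structure NbhdRetract (W : Type*) [TopologicalSpace W] where
  d : C(W, I)
  h : C(I × W, W)
  r : C(W, W)
  h_zero : ∀ w, h (0, w) = w
  h_one : ∀ w, d w < 1 → h (1, w) = r w
  h_r : ∀ t w, h (t, r w) = r w
  d_r : ∀ w, d (r w) = 0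

namespace NbhdRetract

variable {W T : Type*} [TopologicalSpace W] [TopologicalSpace T] (D : NbhdRetract W)

/-- The end of the deformation. -/
def last : C(W, W) := D.h.curry 1

theorem last_r (w : W) : D.last (D.r w) = D.r w := D.h_r 1 w

theorem last_of_lt_one {w : W} (h : D.d w < 1) : D.last w = D.r w := D.h_one w h

theorem homotopicRel_last : (ContinuousMap.id W).HomotopicRel D.last (Set.range D.r) :=
  ⟨⟨⟨D.h, D.h_zero, fun _ => rfl⟩, by rintro t _ ⟨w, rfl⟩; exact D.h_r t w⟩⟩

theorem homotopic_comp_last (c : C(W, T)) : c.Homotopic (c.comp D.last) :=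
  .comp (.refl c) (D.homotopicRel_last.homotopic)

/-- The homotopy is `A` at the subspace, and comes to rest at `d = 1 / 2`. The last
clause says that `c₁` is `t₀` wherever the values of `c` and `A` which it is made of are. -/
theorem exists_eq_on_range (c : C(W, T)) {t₀ : T}
    (A : (c.comp D.r).Homotopy (ContinuousMap.const W t₀)) :
    ∃ c₁ : C(W, T), c.Homotopic c₁ ∧ (∀ w, c₁ (D.r w) = t₀) ∧
      ∀ w, (∀ t, A (t, w) = t₀) → c (D.last w) = t₀ → c₁ w = t₀ := by
  let speed : C(W, I) := ⟨fun w => Set.projIcc 0 1 zero_le_one (1 - 2 * (D.d w : ℝ)),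
    continuous_projIcc.comp (by fun_prop)⟩
  have speed_eq_zero : ∀ {w}, 1 / 2 ≤ (D.d w : ℝ) → speed w = 0 := fun h =>
    Set.projIcc_of_le_left zero_le_one (by linarith)
  have last_eq_r : ∀ {w}, (D.d w : ℝ) ≤ 1 / 2 → D.last w = D.r w := fun h =>
    D.last_of_lt_one (Subtype.coe_lt_coe.1 (h.trans_lt (by norm_num)))
  let F : I × W → T := fun p =>
    if (D.d p.2 : ℝ) ≤ 1 / 2 then A (p.1 * speed p.2, p.2) else c (D.last p.2)
  have hF : Continuous F := by
    refine Continuous.if_le (by fun_prop) (by fun_prop) (by fun_prop) continuous_const ?_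
    intro p hp
    rw [last_eq_r hp.le, speed_eq_zero hp.ge, mul_zero, A.apply_zero, ContinuousMap.comp_apply]
  have F_zero : ∀ w, F (0, w) = c (D.last w) := fun w => by
    by_cases h : (D.d w : ℝ) ≤ 1 / 2
    · simp only [F, if_pos h, last_eq_r h, zero_mul, A.apply_zero, ContinuousMap.comp_apply]
    · simp only [F, if_neg h]
  refine ⟨⟨fun w => F (1, w), by fun_prop⟩,
    (D.homotopic_comp_last c).trans ⟨⟨⟨F, hF⟩, F_zero, fun w => rfl⟩⟩, fun w => ?_,
    fun w hA hc => ?_⟩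
  · have hd : (D.d (D.r w) : ℝ) = 0 := by rw [D.d_r, Set.Icc.coe_zero]
    have hs : speed (D.r w) = 1 := Set.projIcc_of_right_le zero_le_one (by rw [hd]; norm_num)
    simp only [F, ContinuousMap.coe_mk, hd, hs, mul_one, A.apply_one, ContinuousMap.const_apply]
    exact if_pos (by norm_num)
  · simp only [F, ContinuousMap.coe_mk]
    split_ifs
    exacts [hA _, hc]

/-- Deform `f` to `f ∘ last`, then follow the null homotopy up to the time `min 1 (2 * d)`, and
return along its restriction to the subspace. -/
theorem homotopicRel_const (f : C(W, T)) {t₀ : T} (hf : ∀ w, f (D.r w) = t₀)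
    (h : f.Homotopic (ContinuousMap.const W t₀)) :
    f.HomotopicRel (ContinuousMap.const W t₀) (Set.range D.r) := by
  obtain ⟨B⟩ := h
  let time : C(W, I) := ⟨fun w => Set.projIcc 0 1 zero_le_one (2 * (D.d w : ℝ)),
    continuous_projIcc.comp (by fun_prop)⟩
  have time_r : ∀ w, time (D.r w) = 0 := fun w =>
    Set.projIcc_of_le_left zero_le_one (by rw [D.d_r, Set.Icc.coe_zero, mul_zero])
  have follow : ∀ φ : C(W, W), (∀ w, φ (D.r w) = D.r w) →
      (f.comp φ).HomotopicRel ⟨fun w => B (time w, φ w), by fun_prop⟩ (Set.range D.r) := by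
    refine fun φ hφ => ⟨⟨⟨⟨fun p => B (time p.2 * p.1, φ p.2), by fun_prop⟩, fun w => ?_,
      fun w => ?_⟩, ?_⟩⟩
    · simp only [mul_zero, B.apply_zero, ContinuousMap.comp_apply]
    · simp only [mul_one, ContinuousMap.coe_mk]
    · rintro t _ ⟨w, rfl⟩
      simp only [ContinuousMap.coe_mk, hφ, time_r, zero_mul, B.apply_zero,
        ContinuousMap.comp_apply]
  have ends_eq : (⟨fun w => B (time w, D.last w), by fun_prop⟩ : C(W, T)) =
      ⟨fun w => B (time w, D.r w), by fun_prop⟩ := by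
    ext w
    rcases lt_or_ge (D.d w : ℝ) 1 with hd | hd
    · exact congrArg (fun v => B (time w, v)) (D.last_of_lt_one (Subtype.coe_lt_coe.1 hd))
    · have : time w = 1 := Set.projIcc_of_right_le zero_le_one (by linarith)
      simp only [ContinuousMap.coe_mk, this, B.apply_one, ContinuousMap.const_apply]
  have r_r : ∀ w, D.r (D.r w) = D.r w := fun w =>
    (D.last_of_lt_one (by rw [D.d_r]; exact zero_lt_one)).symm.trans (D.last_r w)
  have comp_r : f.comp D.r = ContinuousMap.const W t₀ := ContinuousMap.ext hf
  have comp_last : f.HomotopicRel (f.comp D.last) (Set.range D.r) :=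
    D.homotopicRel_last.comp_continuousMap f
  exact comp_last.trans (((follow _ D.last_r).trans (ends_eq ▸ (follow _ r_r).symm)).trans
    (comp_r ▸ .refl _))

end NbhdRetract

section Powers

variable {X : Type u} [TopologicalSpace X] {x₀ : X} {n : ℕ}

-- Without these two shortcuts, the search times out on products of `CompHaus` spaces.
instance isGeneratedBy_prod_unitInterval (K : Type u) [TopologicalSpace K] [CompactSpace K]
    [T2Space K] : IsGeneratedBy compHausFamily.{u} (K × I) :=
  isGeneratedBy_of_compactlyGenerated (K × I)

instance isGeneratedBy_prod_compact (K L : Type u) [TopologicalSpace K] [CompactSpace K]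
    [T2Space K] [TopologicalSpace L] [CompactSpace L] [T2Space L] :
    IsGeneratedBy compHausFamily.{u} (K × L) :=
  isGeneratedBy_of_compactlyGenerated (K × L)

theorem KPow.coord_mk (v : Fin n → X) : (KPow.mk v).coord = v := rfl

theorem KPow.mk_coord (v : KPow X n) : KPow.mk v.coord = v := rfl

theorem KPow.continuous_coord_apply (i : Fin n) : Continuous fun v : KPow X n => v.coord i :=
  (continuous_apply i).comp KPow.continuous_coord

theorem KPow.continuous_mk_unitInterval {W : Type u} [TopologicalSpace W]
    [IsGeneratedBy compHausFamily.{u} W] {f : I × W → Fin n → X} (hf : Continuous f) :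
    Continuous fun p => KPow.mk (f p) := by
  have h : Continuous fun p : W × I => KPow.mk (f (p.2, p.1)) :=
    continuous_prod_of_test _ fun L a =>
      KPow.continuous_mk (W := L × I) (f := fun p => f (p.2, a p.1)) (by fun_prop)
  exact h.comp continuous_swap

/-- The point obtained from `v` by replacing its `i`-th coordinate by `x`. -/
def KPow.update (v : KPow X n) (i : Fin n) (x : X) : KPow X n :=
  KPow.mk (Function.update v.coord i x)

theorem KPow.coord_update_self (v : KPow X n) (i : Fin n) (x : X) :
    (v.update i x).coord i = x := by
  rw [KPow.update, KPow.coord_mk, Function.update_self]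

theorem KPow.coord_update_of_ne {i j : Fin n} (h : j ≠ i) (v : KPow X n) (x : X) :
    (v.update i x).coord j = v.coord j := by
  rw [KPow.update, KPow.coord_mk, Function.update_of_ne h]

theorem KPow.update_coord (v : KPow X n) (i : Fin n) : v.update i (v.coord i) = v :=
  congrArg KPow.mk (Function.update_eq_self i v.coord)

theorem KPow.update_update (v : KPow X n) (i : Fin n) (x y : X) :
    (v.update i x).update i y = v.update i y := by
  simp only [KPow.update, KPow.coord_mk, Function.update_idem]

theorem KPow.update_comm {i j : Fin n} (h : i ≠ j) (v : KPow X n) (x y : X) :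
    (v.update i x).update j y = (v.update j y).update i x := by
  simp only [KPow.update, KPow.coord_mk, Function.update_comm h]

/-- Replacing the `i`-th coordinate by the constant `x`, as a continuous map of powers. -/
def KPow.updateMap (i : Fin n) (x : X) : C(KPow X n, KPow X n) :=
  ⟨fun v => v.update i x, KPow.continuous_mk (KPow.continuous_coord.update i continuous_const)⟩

theorem KPow.updateMap_apply (i : Fin n) (x : X) (v : KPow X n) :
    KPow.updateMap i x v = v.update i x := rfl

/-- The map of powers `v ↦ v ∘ φ` induced by a map `φ` of the index sets. -/
def KPow.reindex {m : ℕ} (φ : Fin n → Fin m) : C(KPow X m, KPow X n) :=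
  ⟨fun v => KPow.mk (v.coord ∘ φ), KPow.continuous_mk
    (continuous_pi fun j => KPow.continuous_coord_apply (φ j))⟩

theorem exists_nbhdRetract_base (hx₀ : NondegenerateBasePoint x₀) (n : ℕ) :
    ∃ D : NbhdRetract (KPow X n), ∀ w, D.r w = KPow.mk fun _ => x₀ := by
  obtain ⟨d, h, hd, h_zero, h_base, h_one⟩ := hx₀
  refine ⟨{
    d := ⟨fun v => Finset.univ.sup fun i => d (v.coord i), ?_⟩
    h := ⟨fun p => KPow.mk fun i => h (p.1, p.2.coord i), ?_⟩
    r := ContinuousMap.const _ (KPow.mk fun _ => x₀)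
    h_zero := fun w => congrArg KPow.mk (funext fun i => h_zero _)
    h_one := fun w hw => congrArg KPow.mk (funext fun i => h_one _ ?_)
    h_r := fun t w => congrArg KPow.mk (funext fun _ => h_base t)
    d_r := fun w => ?_ }, fun w => rfl⟩
  · exact Continuous.finset_sup_apply fun i _ => d.continuous.comp (KPow.continuous_coord_apply i)
  · refine KPow.continuous_mk_unitInterval (continuous_pi fun i => h.continuous.comp ?_)
    exact continuous_fst.prodMk ((KPow.continuous_coord_apply i).comp continuous_snd)
  · exact (Finset.le_sup (f := fun i => d (w.coord i)) (Finset.mem_univ i)).trans_lt hw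
  · exact le_antisymm (Finset.sup_le fun i _ => ((hd x₀).2 rfl).le) bot_le

theorem exists_nbhdRetract_coord (hx₀ : NondegenerateBasePoint x₀) (i : Fin n) :
    ∃ D : NbhdRetract (KPow X n), D.r = KPow.updateMap i x₀ ∧
      ∀ w, ∃ x, D.last w = w.update i x := by
  obtain ⟨d, h, hd, h_zero, h_base, h_one⟩ := hx₀
  refine ⟨{
    d := ⟨fun v => d (v.coord i), d.continuous.comp (KPow.continuous_coord_apply i)⟩
    h := ⟨fun p => p.2.update i (h (p.1, p.2.coord i)), ?_⟩
    r := KPow.updateMap i x₀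
    h_zero := fun w => by
      rw [ContinuousMap.coe_mk, h_zero, KPow.update_coord]
    h_one := fun w hw => congrArg (w.update i) (h_one _ hw)
    h_r := fun t w => ?_
    d_r := fun w => (hd _).2 (w.coord_update_self i x₀) }, rfl, fun w => ⟨_, rfl⟩⟩
  · refine KPow.continuous_mk_unitInterval ((KPow.continuous_coord.comp continuous_snd).update i
      (h.continuous.comp ?_))
    exact continuous_fst.prodMk ((KPow.continuous_coord_apply i).comp continuous_snd)
  · change (w.update i x₀).update i (h (t, (w.update i x₀).coord i)) = w.update i x₀
    rw [KPow.coord_update_self, h_base, KPow.update_update]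

end Powers

section Diagonal

variable {X : Type u} [TopologicalSpace X] {x₀ : X} {n : ℕ} {T : Type*} [TopologicalSpace T]
  {i j : Fin n}

theorem exists_eq_of_update (hx₀ : NondegenerateBasePoint x₀) (hij : i ≠ j)
    (c : C(KPow X n, T)) {t₀ : T}
    (hi : (c.comp (KPow.updateMap i x₀)).Homotopic (.const _ t₀))
    (hj : (c.comp (KPow.updateMap j x₀)).Homotopic (.const _ t₀)) :
    ∃ c' : C(KPow X n, T), c.Homotopic c' ∧ (∀ v, v.coord i = x₀ → c' v = t₀) ∧
      ∀ v, v.coord j = x₀ → c' v = t₀ := by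
  obtain ⟨Di, hDi, -⟩ := exists_nbhdRetract_coord hx₀ i
  obtain ⟨Dj, hDj, hlast⟩ := exists_nbhdRetract_coord hx₀ j
  obtain ⟨A⟩ := hi
  obtain ⟨c₁, hc₁, hc₁i, -⟩ := Di.exists_eq_on_range c (hDi ▸ A)
  have c₁_update : ∀ v : KPow X n, c₁ (v.update i x₀) = t₀ := fun v => by
    simpa only [hDi, KPow.updateMap_apply] using hc₁i v
  -- The null homotopy for `j` has to be constant where the `i`-th coordinate is trivial.
  obtain ⟨A'⟩ := Di.homotopicRel_const (c₁.comp Dj.r) (t₀ := t₀)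
    (fun v => by
      rw [ContinuousMap.comp_apply, hDi, hDj]
      exact (congrArg c₁ (KPow.update_comm hij v x₀ x₀)).trans (c₁_update _))
    ((hc₁.symm.comp (.refl Dj.r)).trans (hDj ▸ hj))
  obtain ⟨c₂, hc₂, hc₂j, hc₂i⟩ := Dj.exists_eq_on_range c₁ A'.toHomotopy
  refine ⟨c₂, hc₁.trans hc₂, fun v hv => ?_, fun v hv => ?_⟩
  · have v_eq : v.update i x₀ = v := hv ▸ v.update_coord i
    refine hc₂i v (fun t => A'.eq_snd t ⟨v, hDi ▸ v_eq⟩) ?_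
    obtain ⟨x, hx⟩ := hlast v
    rw [hx, ← v_eq, KPow.update_comm hij, c₁_update]
  · have v_eq : Dj.r v = v := hDj ▸ hv ▸ v.update_coord j
    rw [← v_eq, hc₂j]

/-- The map on the smash square induced by `(x, y) ↦ c v'`, where `v'` is obtained from `v` by
replacing its `i`-th and `j`-th coordinates by `x` and `y`. -/
def smashLift (c : C(KPow X n, T)) {t₀ : T} (hi : ∀ v, v.coord i = x₀ → c v = t₀)
    (hj : ∀ v, v.coord j = x₀ → c v = t₀) (hij : i ≠ j) (v : KPow X n) : Smash x₀ 2 → T :=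
  Quotient.lift (fun p : KPow X 2 => c ((v.update i (p.coord 0)).update j (p.coord 1))) (by
    have eq_const : ∀ p : KPow X 2, (∃ k, p.coord k = x₀) →
        c ((v.update i (p.coord 0)).update j (p.coord 1)) = t₀ := by
      rintro p ⟨k, hk⟩
      fin_cases k
      · exact hi _ ((KPow.coord_update_of_ne hij _ _).trans
          ((KPow.coord_update_self _ _ _).trans hk))
      · exact hj _ ((KPow.coord_update_self _ _ _).trans hk)
    rintro p q (rfl | ⟨hp, hq⟩)
    · rfl
    · exact (eq_const p hp).trans (eq_const q hq).symm)

theorem continuous_smashLift (c : C(KPow X n, T)) {t₀ : T} (hi : ∀ v, v.coord i = x₀ → c v = t₀)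
    (hj : ∀ v, v.coord j = x₀ → c v = t₀) (hij : i ≠ j) {L : Type u} [TopologicalSpace L]
    [CompactSpace L] [T2Space L] {a : L → KPow X n} (ha : Continuous a) :
    Continuous fun p : Smash x₀ 2 × L => smashLift c hi hj hij (a p.2) p.1 := by
  refine IsQuotientMap.continuous_lift_prod_left
    (f := (Quotient.mk (smashSetoid x₀ 2))) isQuotientMap_quotient_mk' ?_
  refine continuous_prod_of_test (fun p : KPow X 2 × L =>
    c (((a p.2).update i (p.1.coord 0)).update j (p.1.coord 1))) fun L' b => ?_
  have hb : ∀ k, Continuous fun p : L' × L => (b p.1).coord k := fun k =>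
    (KPow.continuous_coord_apply k).comp (b.continuous.comp continuous_fst)
  exact c.continuous.comp (KPow.continuous_mk (W := L' × L)
    (((KPow.continuous_coord.comp (ha.comp continuous_snd)).update i (hb 0)).update j (hb 1)))

theorem homotopic_const_of_reducedDiagonal [CompactlyGeneratedSpace X]
    (hdiag : (reducedDiagonal x₀ 2).Homotopic (.const X (Smash.base x₀ 2)))
    (c : C(KPow X n, T)) {t₀ : T} (hi : ∀ v, v.coord i = x₀ → c v = t₀)
    (hj : ∀ v, v.coord j = x₀ → c v = t₀) (hij : i ≠ j) :
    (c.comp (KPow.reindex (Function.update id j i))).Homotopic (.const _ t₀) := by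
  obtain ⟨N⟩ := hdiag
  have hF : Continuous fun p : KPow X n × I =>
      smashLift c hi hj hij p.1 (N (p.2, p.1.coord i)) := by
    refine continuous_prod_of_test _ fun L a => ?_
    have ha : Continuous fun l : L => (a l).coord i :=
      (KPow.continuous_coord_apply i).comp a.continuous
    have hN : Continuous fun p : L × I => (N (p.2, (a p.1).coord i), p.1) :=
      (N.continuous.comp (continuous_snd.prodMk (ha.comp continuous_fst))).prodMk continuous_fst
    exact (continuous_smashLift c hi hj hij a.continuous).comp hN
  refine ⟨⟨⟨_, hF.comp continuous_swap⟩, fun v => ?_, fun v => ?_⟩⟩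
  · have diag : (v.update i (v.coord i)).update j (v.coord i) =
        KPow.reindex (Function.update id j i) v := by
      rw [KPow.update_coord]
      exact congrArg KPow.mk (Function.comp_update v.coord id j i).symm
    simp only [Function.comp_apply, Prod.swap_prod_mk, N.apply_zero]
    exact congrArg c diag
  · simp only [Function.comp_apply, Prod.swap_prod_mk, N.apply_one]
    exact hi _ ((KPow.coord_update_of_ne hij _ _).trans (KPow.coord_update_self _ _ _))

theorem homotopic_const_diagonal [CompactlyGeneratedSpace X] (hx₀ : NondegenerateBasePoint x₀)
    (hcat : WeakLSCatLT x₀ 2) {m : ℕ} (hij : i ≠ j) (φ : Fin n → Fin m) (hφ : φ i = φ j)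
    (c : C(KPow X n, T)) {t₀ : T} (hi : (c.comp (KPow.updateMap i x₀)).Homotopic (.const _ t₀))
    (hj : (c.comp (KPow.updateMap j x₀)).Homotopic (.const _ t₀)) :
    (c.comp (KPow.reindex φ)).Homotopic (.const _ t₀) := by
  obtain ⟨c', hc', hc'i, hc'j⟩ := exists_eq_of_update hx₀ hij c hi hj
  have null := homotopic_const_of_reducedDiagonal hcat.homotopic c' hc'i hc'j hij
  have φ_update : φ ∘ Function.update id j i = φ := by
    rw [Function.comp_update, Function.comp_id, hφ, Function.update_eq_self]
  have reindex_comp : (KPow.reindex (X := X) (Function.update id j i)).comp (KPow.reindex φ) =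
      KPow.reindex φ := by
    conv_rhs => rw [← φ_update]
    rfl
  rw [← reindex_comp, ← ContinuousMap.comp_assoc]
  exact ((hc'.comp (.refl _)).trans null).comp (.refl _)

end Diagonal

section Pullback

variable {W W' : Type u} [TopologicalSpace W] [IsGeneratedBy compHausFamily.{u} W]
  [TopologicalSpace W'] [IsGeneratedBy compHausFamily.{u} W'] {w₀ : W} {w₀' : W'}
  {M : Type u} [TopologicalSpace M] [Monoid M] [ContinuousKMul M]

/-- The pointed homotopy class of a pointed map. -/
def PointedClasses.mk (f : PointedMap w₀ M) : PointedClasses w₀ M := Quotient.mk _ f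

/-- Precomposition with a pointed map, on pointed homotopy classes. -/
def PointedClasses.pullback (φ : C(W', W)) (hφ : φ w₀' = w₀) :
    PointedClasses w₀ M →* PointedClasses w₀' M where
  toFun := Quotient.map (fun f => ⟨f.1.comp φ, by
    rw [ContinuousMap.comp_apply, hφ, f.2]⟩) fun f g ⟨F⟩ =>
      ⟨⟨F.toHomotopy.compContinuousMap φ, by
        rintro t _ rfl
        exact F.eq_fst t hφ⟩⟩
  map_one' := rfl
  map_mul' := by
    rintro ⟨f⟩ ⟨g⟩
    rfl

theorem PointedClasses.homotopic_of_mk_eq_one {f : PointedMap w₀ M}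
    (h : PointedClasses.mk f = 1) : f.1.Homotopic (.const W 1) :=
  (Quotient.exact h : f.1.HomotopicRel (.const W 1) {w₀}).homotopic

end Pullback

section PowerClasses

variable {X : Type u} [TopologicalSpace X] {x₀ : X} {n : ℕ} {M : Type u} [TopologicalSpace M]
  [Monoid M] [ContinuousKMul M]

/-- The monoid `[X^n, M]`. -/
abbrev PowerClasses (x₀ : X) (n : ℕ) (M : Type u) [TopologicalSpace M] [Monoid M] : Type u :=
  PointedClasses (KPow.mk fun _ : Fin n => x₀) M

theorem PowerClasses.mk_eq_one_of_homotopic (hx₀ : NondegenerateBasePoint x₀)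
    {f : PointedMap (KPow.mk fun _ : Fin n => x₀) M} (h : f.1.Homotopic (.const _ 1)) :
    PointedClasses.mk f = 1 := by
  obtain ⟨D, hD⟩ := exists_nbhdRetract_base hx₀ n
  have range_r : Set.range D.r = {KPow.mk fun _ : Fin n => x₀} := by
    have : Nonempty (KPow X n) := ⟨KPow.mk fun _ => x₀⟩
    rw [funext hD, Set.range_const]
  have pointed : f.1.HomotopicRel (.const _ 1) {KPow.mk fun _ : Fin n => x₀} :=
    range_r ▸ D.homotopicRel_const f.1 (fun w => by rw [hD, f.2]) h
  exact Quotient.sound (s := pointedHomotopySetoid _ M) (b := 1) pointed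

/-- The monoid homomorphism `[X^n, M] → [X^m, M]` given by composition with `v ↦ v ∘ φ`. -/
abbrev PowerClasses.reindex {m : ℕ} (φ : Fin n → Fin m) :
    PowerClasses x₀ n M →* PowerClasses x₀ m M :=
  PointedClasses.pullback (KPow.reindex φ) rfl

/-- The endomorphism of `[X^n, M]` which sets the `i`-th coordinate to the base point. -/
abbrev PowerClasses.trivialize (i : Fin n) : PowerClasses x₀ n M →* PowerClasses x₀ n M :=
  PointedClasses.pullback (KPow.updateMap i x₀) (KPow.update_coord (KPow.mk fun _ => x₀) i)

theorem PowerClasses.reindex_reindex {m l : ℕ} (φ : Fin n → Fin m) (ψ : Fin m → Fin l)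
    (c : PowerClasses x₀ n M) : reindex ψ (reindex φ c) = reindex (ψ ∘ φ) c := by
  obtain ⟨f⟩ := c
  rfl

theorem PowerClasses.reindex_id (c : PowerClasses x₀ n M) : reindex id c = c := by
  obtain ⟨f⟩ := c
  rfl

theorem PowerClasses.trivialize_reindex {m : ℕ} {φ : Fin n → Fin m} (hφ : φ.Injective) (j : Fin n)
    (c : PowerClasses x₀ n M) :
    trivialize (φ j) (reindex φ c) = reindex φ (trivialize j c) := by
  obtain ⟨f⟩ := c
  refine congrArg PointedClasses.mk (Subtype.ext (ContinuousMap.ext fun v => congrArg f.1 ?_))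
  exact congrArg KPow.mk (Function.update_comp_eq_of_injective v.coord hφ j x₀)

theorem PowerClasses.reindex_eq_one [CompactlyGeneratedSpace X] (hx₀ : NondegenerateBasePoint x₀)
    (hcat : WeakLSCatLT x₀ 2) {m : ℕ} {i j : Fin n} (hij : i ≠ j) (φ : Fin n → Fin m)
    (hφ : φ i = φ j) {c : PowerClasses x₀ n M} (hi : trivialize i c = 1)
    (hj : trivialize j c = 1) : reindex φ c = 1 := by
  obtain ⟨f⟩ := c
  exact mk_eq_one_of_homotopic hx₀ (homotopic_const_diagonal hx₀ hcat hij φ hφ f.1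
    (PointedClasses.homotopic_of_mk_eq_one hi) (PointedClasses.homotopic_of_mk_eq_one hj))

/-- The map `{1, …, n + 1} → {1, …, n}` that identifies the last index with `p`. -/
def mergeLast (p : Fin n) : Fin (n + 1) → Fin n := Fin.snoc id p

theorem mergeLast_castSucc (p i : Fin n) : mergeLast p i.castSucc = i := Fin.snoc_castSucc ..

theorem mergeLast_last (p : Fin n) : mergeLast p (Fin.last n) = p := Fin.snoc_last ..

/-- The injection `{1, …, n} → {1, …, n + 1}` that moves `p` to the last index. -/
def moveToLast (p : Fin n) : Fin n → Fin (n + 1) := Function.update Fin.castSucc p (Fin.last n)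

theorem moveToLast_self (p : Fin n) : moveToLast p p = Fin.last n := Function.update_self ..

theorem mergeLast_comp_moveToLast (p : Fin n) : mergeLast p ∘ moveToLast p = id := by
  have : mergeLast p ∘ Fin.castSucc = id := funext (mergeLast_castSucc p)
  rw [moveToLast, Function.comp_update, this, mergeLast_last]
  exact Function.update_eq_self p id

theorem moveToLast_injective (p : Fin n) : (moveToLast p).Injective :=
  (Function.leftInverse_iff_comp.2 (mergeLast_comp_moveToLast p)).injective

theorem PowerClasses.reindex_mergeLast_eq_one [CompactlyGeneratedSpace X]
    (hx₀ : NondegenerateBasePoint x₀) (hcat : WeakLSCatLT x₀ 2) (p : Fin n)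
    {c : PowerClasses x₀ (n + 1) M} (hp : trivialize p.castSucc c = 1)
    (hlast : trivialize (Fin.last n) c = 1) : reindex (mergeLast p) c = 1 :=
  reindex_eq_one hx₀ hcat p.castSucc_lt_last.ne _
    ((mergeLast_castSucc p p).trans (mergeLast_last p).symm) hp hlast

/-- The commutator is the restriction to the diagonal of the commutator in which the variable `p`
of the entries of `l'` has been made independent of the variable `p` of the entries of `l`. -/
theorem PowerClasses.iteratedComm_append_eq_one [CompactlyGeneratedSpace X]
    (hx₀ : NondegenerateBasePoint x₀) (hcat : WeakLSCatLT x₀ 2) (p : Fin n)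
    {l l' : List (PowerClasses x₀ n M)ˣ} (hl : ∃ u ∈ l, trivialize p (u : PowerClasses x₀ n M) = 1)
    (hl' : ∃ u ∈ l', trivialize p (u : PowerClasses x₀ n M) = 1) :
    iteratedComm (l ++ l') = 1 := by
  obtain ⟨u, hul, hu⟩ := hl
  obtain ⟨u', hul', hu'⟩ := hl'
  let a : (PowerClasses x₀ n M)ˣ →* (PowerClasses x₀ (n + 1) M)ˣ := Units.map (reindex Fin.castSucc)
  let b : (PowerClasses x₀ n M)ˣ →* (PowerClasses x₀ (n + 1) M)ˣ :=
    Units.map (reindex (moveToLast p))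
  let δ : (PowerClasses x₀ (n + 1) M)ˣ →* (PowerClasses x₀ n M)ˣ :=
    Units.map (reindex (mergeLast p))
  have δ_a : ∀ u, δ (a u) = u := fun u => Units.ext <| (reindex_reindex _ _ _).trans <| by
    rw [show mergeLast p ∘ Fin.castSucc = id from funext (mergeLast_castSucc p), reindex_id]
  have δ_b : ∀ u, δ (b u) = u := fun u => Units.ext <| (reindex_reindex _ _ _).trans <| by
    rw [mergeLast_comp_moveToLast, reindex_id]
  have δ_comm : δ (iteratedComm (l.map a ++ l'.map b)) = iteratedComm (l ++ l') := by
    simp only [map_iteratedComm, List.map_append, List.map_map, Function.comp_def, δ_a, δ_b,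
      List.map_id']
  have trivialize_comm : ∀ (q : Fin (n + 1)) (v : (PowerClasses x₀ (n + 1) M)ˣ),
      v ∈ l.map a ++ l'.map b → trivialize q (v : PowerClasses x₀ (n + 1) M) = 1 →
      trivialize q ((iteratedComm (l.map a ++ l'.map b) : (PowerClasses x₀ (n + 1) M)ˣ) :
        PowerClasses x₀ (n + 1) M) = 1 := fun q v hv hvq => by
    rw [← Units.coe_map, map_iteratedComm, iteratedComm_eq_one, Units.val_one]
    exact List.mem_map.2 ⟨v, hv, Units.ext hvq⟩
  rw [← δ_comm]
  refine Units.ext (reindex_mergeLast_eq_one hx₀ hcat p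
    (trivialize_comm _ (a u) (List.mem_append_left _ (List.mem_map_of_mem hul)) ?_)
    (trivialize_comm _ (b u') (List.mem_append_right _ (List.mem_map_of_mem hul')) ?_))
  · exact (trivialize_reindex (Fin.castSucc_injective n) p _).trans (by rw [hu, map_one])
  · rw [← moveToLast_self p]
    exact (trivialize_reindex (moveToLast_injective p) p _).trans (by rw [hu', map_one])

end PowerClasses

section Relations

variable {X : Type u} [TopologicalSpace X] {x₀ : X} {n k : ℕ}

theorem reindex_wordClass {m : ℕ} (φ : Fin n → Fin m) (i : Fin k → Fin n) :
    PowerClasses.reindex φ (wordClass x₀ i) = wordClass x₀ (φ ∘ i) := rfl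

theorem trivialize_wordClass (i : Fin k → Fin n) (s : Fin k) :
    PowerClasses.trivialize (i s) (wordClass x₀ i) = 1 := by
  refine congrArg (Quotient.mk _) (Subtype.ext (ContinuousMap.ext fun v => ?_))
  change James.word (Smash.base x₀ k) [Smash.mk x₀ _] = 1
  rw [Smash.mk_eq_base, James.word_base]
  exact ⟨s, KPow.coord_update_self v (i s) x₀⟩

variable [CompactlyGeneratedSpace X]

theorem wordClass_eq_one (hx₀ : NondegenerateBasePoint x₀) (hcat : WeakLSCatLT x₀ 2)
    {i : Fin k → Fin n} (hi : ¬ Function.Injective i) : wordClass x₀ i = 1 := by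
  obtain ⟨s, t, hi_eq, hst⟩ := Function.not_injective_iff.1 hi
  let i' : Fin k → Fin (n + 1) := Function.update (Fin.castSucc ∘ i) t (Fin.last n)
  have i'_s : i' s = (i t).castSucc :=
    (Function.update_of_ne hst ..).trans (congrArg Fin.castSucc hi_eq)
  have i'_t : i' t = Fin.last n := Function.update_self ..
  have merge_i' : mergeLast (i t) ∘ i' = i := by
    rw [Function.comp_update, mergeLast_last, ← Function.comp_assoc,
      show mergeLast (i t) ∘ Fin.castSucc = id from funext (mergeLast_castSucc _)]
    exact Function.update_eq_self t i
  rw [← merge_i', ← reindex_wordClass]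
  refine PowerClasses.reindex_mergeLast_eq_one hx₀ hcat (i t) ?_ ?_
  · exact i'_s ▸ trivialize_wordClass i' s
  · exact i'_t ▸ trivialize_wordClass i' t

theorem iteratedComm_wordClass_eq_one (hx₀ : NondegenerateBasePoint x₀) (hcat : WeakLSCatLT x₀ 2)
    {u : (Fin k → Fin n) → (CohenTarget x₀ n k)ˣ}
    (hu : ∀ i, (u i : CohenTarget x₀ n k) = wordClass x₀ i) {L : List (Fin k → Fin n)}
    (hL : ¬ (L.flatMap fun i => List.ofFn i).Nodup) : iteratedComm (L.map u) = 1 := by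
  rw [List.nodup_flatMap, not_and_or] at hL
  rcases hL with hL | hL
  · push Not at hL
    obtain ⟨i, hiL, hi⟩ := hL
    refine iteratedComm_eq_one (List.mem_map.2 ⟨i, hiL, Units.ext ?_⟩)
    exact (hu i).trans (wordClass_eq_one hx₀ hcat (mt List.nodup_ofFn.2 hi))
  · obtain ⟨l, l', rfl, i, hi, j, hj, hij⟩ := exists_append_of_not_pairwise hL
    obtain ⟨p, hpi, hpj⟩ : ∃ p, p ∈ List.ofFn i ∧ p ∈ List.ofFn j := by
      simpa only [List.disjoint_left, Function.onFun, not_forall, not_not, exists_prop] using hij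
    obtain ⟨s, rfl⟩ := (List.mem_ofFn' _ _).1 hpi
    obtain ⟨t, hst⟩ := (List.mem_ofFn' _ _).1 hpj
    rw [List.map_append]
    refine PowerClasses.iteratedComm_append_eq_one hx₀ hcat (i s)
      ⟨u i, List.mem_map_of_mem hi, ?_⟩ ⟨u j, List.mem_map_of_mem hj, ?_⟩
    · exact hu i ▸ trivialize_wordClass i s
    · exact hu j ▸ hst ▸ trivialize_wordClass j t

theorem not_nodup_flatMap_ofFn (hk : 1 ≤ k) {α : Type*} {l : List (Fin k → α)} (hl : ¬ l.Nodup) :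
    ¬ (l.flatMap fun i => List.ofFn i).Nodup := by
  refine fun h => hl ((List.nodup_flatMap.1 h).2.imp ?_)
  rintro i _ hdisj rfl
  have head_mem : i ⟨0, hk⟩ ∈ List.ofFn i := (List.mem_ofFn' _ _).2 ⟨_, rfl⟩
  exact hdisj head_mem head_mem

theorem exists_cohenGroup_hom (hx₀ : NondegenerateBasePoint x₀) (hcat : WeakLSCatLT x₀ 2)
    (hk : 1 ≤ k) (h : ∀ i : Fin k → Fin n, IsUnit (wordClass x₀ i)) :
    ∃ e : CohenGroup n k →* CohenTarget x₀ n k,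
      ∀ i : Fin k → Fin n, e (PresentedGroup.of i) = wordClass x₀ i := by
  choose u hu using h
  have commutator_rel : ∀ L : List (Fin k → Fin n), ¬ (L.flatMap fun i => List.ofFn i).Nodup →
      iteratedComm (L.map u) = 1 := fun L => iteratedComm_wordClass_eq_one hx₀ hcat hu
  have rel : ∀ r ∈ {r : FreeGroup (Fin k → Fin n) | CohenRelator n k r},
      FreeGroup.lift u r = 1 := by
    rintro r (⟨i, hi⟩ | ⟨L, hL⟩ | ⟨L⟩)
    · rw [FreeGroup.lift_apply_of]
      exact Units.ext ((hu i).trans (wordClass_eq_one hx₀ hcat hi))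
    · simpa only [map_iteratedComm, List.map_map, Function.comp_def, FreeGroup.lift_apply_of]
        using commutator_rel L hL
    · simp only [map_mul, map_inv, map_zpow, map_iteratedComm, List.map_map, Function.comp_def,
        FreeGroup.lift_apply_of]
      rw [iteratedComm_zpow u (fun l hl => commutator_rel l (not_nodup_flatMap_ofFn hk hl)),
        mul_inv_cancel]
  refine ⟨(Units.coeHom _).comp (PresentedGroup.toGroup rel), fun i => ?_⟩
  rw [MonoidHom.comp_apply, PresentedGroup.toGroup.of]
  exact hu i

end Relations

section Ball

open Metric Set

theorem continuousOn_ite_le {Y T : Type*} [TopologicalSpace Y] [TopologicalSpace T] {s : Set Y}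
    (hs : IsClosed s) {f g : Y → T} {a b : Y → ℝ} (ha : Continuous a) (hb : Continuous b)
    (hf : ContinuousOn f (s ∩ {y | a y ≤ b y})) (hg : ContinuousOn g (s ∩ {y | b y ≤ a y}))
    (h : ∀ y ∈ s, a y = b y → f y = g y) :
    ContinuousOn (fun y => if a y ≤ b y then f y else g y) s := by
  have hs' : s = (s ∩ {y | a y ≤ b y}) ∪ (s ∩ {y | b y ≤ a y}) := by
    ext y
    simp only [mem_union, mem_inter_iff, mem_ofPred_eq, ← and_or_left, le_total, and_true]
  rw [hs']
  refine ContinuousOn.union_of_isClosed (hf.congr fun y hy => if_pos hy.2)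
    (hg.congr fun y hy => ?_) (hs.inter (isClosed_le ha hb)) (hs.inter (isClosed_le hb ha))
  by_cases hab : a y ≤ b y
  · simp only [if_pos hab, h y hy.1 (le_antisymm hab hy.2)]
  · simp only [if_neg hab]

section Prism

variable {V : Type*} [NormedAddCommGroup V]

theorem mem_sphere_prod_iff {x : V × ℝ} : x ∈ sphere (0 : V × ℝ) 1 ↔
    (x.1 ∈ sphere (0 : V) 1 ∧ x.2 ∈ Icc (-1 : ℝ) 1) ∨
      x.1 ∈ closedBall (0 : V) 1 ∧ (x.2 = -1 ∨ x.2 = 1) := by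
  rw [mem_sphere_zero_iff_norm, mem_sphere_zero_iff_norm, mem_closedBall_zero_iff, Prod.norm_def,
    Real.norm_eq_abs, mem_Icc, ← abs_le, or_comm (a := x.2 = -1), ← abs_eq zero_le_one]
  constructor
  · intro h
    rcases max_choice ‖x.1‖ |x.2| with e | e
    · exact Or.inl ⟨e ▸ h, (le_max_right _ _).trans h.le⟩
    · exact Or.inr ⟨(le_max_left _ _).trans h.le, e ▸ h⟩
  · rintro (⟨h, h'⟩ | ⟨h, h'⟩)
    · rw [h, max_eq_left h']
    · rw [h', max_eq_right h]

theorem closedBall_prod_eq : closedBall (0 : V × ℝ) 1 = closedBall (0 : V) 1 ×ˢ Icc (-1 : ℝ) 1 := by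
  rw [← Prod.mk_zero_zero, ← closedBall_prod_same, Real.closedBall_eq_Icc, zero_sub, zero_add]

theorem sphere_prod_subset : sphere (0 : V × ℝ) 1 ⊆ closedBall (0 : V) 1 ×ˢ Icc (-1 : ℝ) 1 :=
  fun _ hz => closedBall_prod_eq.subset (sphere_subset_closedBall hz)

theorem continuousOn_ite_bottom {Y T : Type*} [TopologicalSpace Y] [TopologicalSpace T]
    {s : Set Y} (hs : IsClosed s) {u : Y → V × ℝ} (hu : Continuous u)
    (hus : MapsTo u s (sphere 0 1))
    {f g : Y → T} (hf : ContinuousOn f s) (hg : ContinuousOn g s)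
    (h : ∀ y ∈ s, (u y).1 ∈ sphere (0 : V) 1 → (u y).2 = -1 → f y = g y) :
    ContinuousOn (fun y => if (u y).2 = -1 then f y else g y) s := by
  have isClosed_bottom : IsClosed {y | (u y).2 = -1} :=
    isClosed_eq (continuous_snd.comp hu) continuous_const
  have isClosed_rest : IsClosed {y | (u y).1 ∈ sphere (0 : V) 1 ∨ (u y).2 = 1} :=
    (isClosed_sphere.preimage (continuous_fst.comp hu)).union
      (isClosed_eq (continuous_snd.comp hu) continuous_const)
  refine (ContinuousOn.union_of_isClosed
    ((hf.mono inter_subset_left).congr fun y hy => if_pos hy.2)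
    ((hg.mono inter_subset_left).congr fun y hy => ?_) (hs.inter isClosed_bottom)
    (hs.inter isClosed_rest)).mono fun y hy => ?_
  · split_ifs with hy'
    · rcases hy.2 with h' | h'
      · exact h y hy.1 h' hy'
      · norm_num [h'] at hy'
    · rfl
  · rcases mem_sphere_prod_iff.1 (hus hy) with ⟨h', -⟩ | ⟨-, h' | h'⟩
    exacts [Or.inr ⟨hy, Or.inl h'⟩, Or.inl ⟨hy, h'⟩, Or.inr ⟨hy, Or.inr h'⟩]

end Prism

section Extension

variable {V T : Type*} [NormedAddCommGroup V] [NormedSpace ℝ V] [TopologicalSpace T]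

theorem inv_norm_smul_mem_sphere {x : V} (hx : ‖x‖ ≠ 0) : ‖x‖⁻¹ • x ∈ sphere (0 : V) 1 := by
  rw [mem_sphere_zero_iff_norm, norm_smul, norm_inv, norm_norm, inv_mul_cancel₀ hx]

theorem continuousOn_comp_projBottom {F : V → T} (hF : ContinuousOn F (closedBall 0 1)) :
    ContinuousOn (fun z : V × ℝ => F ((2 / (2 - z.2)) • z.1))
      (closedBall 0 1 ×ˢ Icc 0 1 ∩ {z | 2 * ‖z.1‖ ≤ 2 - z.2}) := by
  refine hF.comp (ContinuousOn.smul (continuousOn_const.div (by fun_prop) ?_) continuousOn_fst) ?_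
  · rintro ⟨x, t⟩ ⟨⟨-, -, ht⟩, -⟩
    dsimp only at ht ⊢
    linarith
  · rintro ⟨x, t⟩ ⟨⟨-, -, ht⟩, hx⟩
    simp only [mem_ofPred_eq] at ht hx
    rw [mem_closedBall_zero_iff, norm_smul, Real.norm_of_nonneg (by bound), div_mul_eq_mul_div]
    exact (div_le_one (by linarith)).2 hx

theorem continuousOn_comp_projSide {h : V × ℝ → T} (hh : ContinuousOn h (sphere 0 1 ×ˢ Icc 0 1)) :
    ContinuousOn (fun z : V × ℝ => h (‖z.1‖⁻¹ • z.1, 2 - (2 - z.2) / ‖z.1‖))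
      (closedBall 0 1 ×ˢ Icc 0 1 ∩ {z | 2 - z.2 ≤ 2 * ‖z.1‖}) := by
  have norm_ne : ∀ z ∈ closedBall (0 : V) 1 ×ˢ Icc (0 : ℝ) 1 ∩ {z | 2 - z.2 ≤ 2 * ‖z.1‖},
      ‖z.1‖ ≠ 0 := by
    rintro ⟨x, t⟩ ⟨⟨-, -, ht⟩, hx⟩
    simp only [mem_ofPred_eq] at ht hx
    linarith
  refine hh.comp (((continuousOn_fst.norm.inv₀ norm_ne).smul continuousOn_fst).prodMk
    (continuousOn_const.sub (ContinuousOn.div (by fun_prop) continuousOn_fst.norm norm_ne))) ?_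
  rintro ⟨x, t⟩ ⟨⟨hx, -, ht⟩, hxt⟩
  simp only [mem_ofPred_eq, mem_closedBall_zero_iff] at ht hx hxt
  have norm_pos : 0 < ‖x‖ := by linarith
  refine ⟨inv_norm_smul_mem_sphere norm_pos.ne', ?_, ?_⟩
  · linarith [(div_le_iff₀ norm_pos).2 hxt]
  · linarith [(one_le_div norm_pos).2 (by linarith : ‖x‖ ≤ 2 - t)]

/-- The cylinder on the ball retracts onto its bottom and sides by projection from `(0, 2)`. -/
theorem exists_homotopy_extension {F : V → T} {h : V × ℝ → T} (hF : ContinuousOn F (closedBall 0 1))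
    (hh : ContinuousOn h (sphere 0 1 ×ˢ Icc 0 1)) (h₀ : ∀ x ∈ sphere (0 : V) 1, h (x, 0) = F x) :
    ∃ H : V × ℝ → T, ContinuousOn H (closedBall 0 1 ×ˢ Icc 0 1) ∧
      (∀ x ∈ closedBall (0 : V) 1, H (x, 0) = F x) ∧
      ∀ x ∈ sphere (0 : V) 1, ∀ t ∈ Icc (0 : ℝ) 1, H (x, t) = h (x, t) := by
  refine ⟨fun z => if 2 * ‖z.1‖ ≤ 2 - z.2 then F ((2 / (2 - z.2)) • z.1)
      else h (‖z.1‖⁻¹ • z.1, 2 - (2 - z.2) / ‖z.1‖),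
    continuousOn_ite_le (isClosed_closedBall.prod isClosed_Icc) (by fun_prop) (by fun_prop)
      (continuousOn_comp_projBottom hF) (continuousOn_comp_projSide hh) ?_,
    fun x hx => ?_, fun x hx t ht => ?_⟩
  · rintro ⟨x, t⟩ ⟨-, -, ht⟩ hxt
    dsimp only at ht hxt ⊢
    have norm_ne : ‖x‖ ≠ 0 := by linarith
    rw [← hxt, mul_div_cancel_right₀ _ norm_ne, sub_self, h₀ _ (inv_norm_smul_mem_sphere norm_ne)]
    congr 2
    field_simp
  · rw [mem_closedBall_zero_iff] at hx
    dsimp only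
    rw [if_pos (by linarith), sub_zero, div_self two_ne_zero, one_smul]
  · rw [mem_sphere_zero_iff_norm] at hx
    simp only [hx, mul_one, inv_one, one_smul, div_one, sub_sub_cancel]
    split_ifs with ht'
    · have : t = 0 := le_antisymm (by linarith) ht.1
      rw [this, h₀ x (mem_sphere_zero_iff_norm.2 hx), sub_zero, div_self two_ne_zero, one_smul]
    · rfl

/-- The restriction of `ψ` to the unit sphere extends continuously over the closed unit ball. -/
def ExtendsOverBall (ψ : V → T) : Prop :=
  ∃ Ψ : V → T, ContinuousOn Ψ (closedBall 0 1) ∧ EqOn Ψ ψ (sphere 0 1)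

theorem ExtendsOverBall.of_homotopic {ψ Ψ : V → T} {h : V × ℝ → T}
    (hΨ : ContinuousOn Ψ (closedBall 0 1)) (hh : ContinuousOn h (sphere 0 1 ×ˢ Icc 0 1))
    (h₀ : ∀ x ∈ sphere (0 : V) 1, h (x, 0) = ψ x) (h₁ : ∀ x ∈ sphere (0 : V) 1, h (x, 1) = Ψ x) :
    ExtendsOverBall ψ := by
  obtain ⟨H, hH, -, H_eq⟩ := exists_homotopy_extension (h := fun z => h (z.1, 1 - z.2)) hΨ
    (hh.comp (by fun_prop) fun z hz => ⟨hz.1, by linarith [hz.2.2], by linarith [hz.2.1]⟩)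
    (fun x hx => by rw [sub_zero, h₁ x hx])
  refine ⟨fun x => H (x, 1), hH.comp (by fun_prop) fun x hx => ⟨hx, right_mem_Icc.2 zero_le_one⟩,
    fun x hx => ?_⟩
  exact (H_eq x hx 1 (right_mem_Icc.2 zero_le_one)).trans (by rw [sub_self, h₀ x hx])

theorem exists_extension_of_top {H : V × ℝ → T} {t₀ : T}
    (hH : ContinuousOn H (sphere 0 1 ×ˢ Icc (-1) 1))
    (H₁ : ∀ x ∈ sphere (0 : V) 1, H (x, 1) = t₀) :
    ∃ K : V × ℝ → T, ContinuousOn K (closedBall 0 1 ×ˢ Icc (-1) 1) ∧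
      EqOn K H (sphere 0 1 ×ˢ Icc (-1) 1) ∧ ∀ x ∈ closedBall (0 : V) 1, K (x, 1) = t₀ := by
  obtain ⟨K, hK, K₀, K_eq⟩ := exists_homotopy_extension (F := fun _ => t₀)
    (h := fun z => H (z.1, 1 - 2 * z.2)) continuousOn_const
    (hH.comp (by fun_prop) fun z hz => ⟨hz.1, by linarith [hz.2.2], by linarith [hz.2.1]⟩)
    (fun x hx => by rw [mul_zero, sub_zero, H₁ x hx])
  refine ⟨fun z => K (z.1, (1 - z.2) / 2), hK.comp (by fun_prop) fun z hz =>
    ⟨hz.1, by linarith [hz.2.2], by linarith [hz.2.1]⟩, fun z hz => ?_, fun x hx => ?_⟩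
  · refine (K_eq z.1 hz.1 _ ⟨by linarith [hz.2.2], by linarith [hz.2.1]⟩).trans ?_
    rw [mul_div_cancel₀ _ two_ne_zero, sub_sub_cancel]
  · simp only [sub_self, zero_div, K₀ x hx]

theorem exists_extension_below {L h : V × ℝ → T}
    (hL : ContinuousOn L (closedBall 0 1 ×ˢ Icc (-1) 1))
    (hh : ContinuousOn h (sphere 0 1 ×ˢ Icc 0 1))
    (h₀ : ∀ x ∈ sphere (0 : V) 1, h (x, 0) = L (x, -1)) :
    ∃ G : V × ℝ → T, ContinuousOn G (closedBall 0 1 ×ˢ Icc (-1) 1) ∧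
      (∀ x ∈ closedBall (0 : V) 1, ∀ t ∈ Icc (-1 : ℝ) 1, G (x, (t + 1) / 2) = L (x, t)) ∧
      ∀ x ∈ sphere (0 : V) 1, ∀ t ∈ Icc (0 : ℝ) 1, G (x, -t) = h (x, t) := by
  have bottom_mem : (-1 : ℝ) ∈ Icc (-1 : ℝ) 1 := left_mem_Icc.2 (by norm_num)
  obtain ⟨Q, hQ, Q₀, Q_eq⟩ := exists_homotopy_extension (F := fun x => L (x, -1))
    (hL.comp (by fun_prop) fun x hx => ⟨hx, bottom_mem⟩) hh h₀
  have eq_at_zero : ∀ x ∈ closedBall (0 : V) 1, Q (x, -0) = L (x, 2 * 0 - 1) := fun x hx => by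
    rw [neg_zero, Q₀ x hx, mul_zero, zero_sub]
  refine ⟨fun z => if z.2 ≤ 0 then Q (z.1, -z.2) else L (z.1, 2 * z.2 - 1),
    continuousOn_ite_le (isClosed_closedBall.prod isClosed_Icc) (by fun_prop) (by fun_prop)
      (hQ.comp (by fun_prop) ?_) (hL.comp (by fun_prop) ?_) ?_, fun x hx t ht => ?_,
    fun x hx t ht => ?_⟩
  · rintro ⟨x, t⟩ ⟨⟨hx, ht⟩, ht'⟩
    exact ⟨hx, neg_nonneg.2 ht', neg_le.1 ht.1⟩
  · rintro ⟨x, t⟩ ⟨⟨hx, ht⟩, ht'⟩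
    simp only [mem_ofPred_eq] at ht'
    exact ⟨hx, by linarith, by linarith [ht.2]⟩
  · rintro ⟨x, t⟩ ⟨hx, -⟩ rfl
    exact eq_at_zero x hx
  · dsimp only
    rw [mul_div_cancel₀ _ two_ne_zero, add_sub_cancel_right]
    split_ifs with ht'
    · obtain rfl : t = -1 := le_antisymm (by linarith) ht.1
      rw [neg_add_cancel, zero_div, neg_zero, Q₀ x hx]
    · rfl
  · dsimp only
    rw [if_pos (neg_nonpos.2 ht.1), neg_neg, Q_eq x hx t ht]

/-- At time `s` the sides and the top carry the restriction of `G` to heights above `-s`, and the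
bottom carries `P` at time `s`. -/
theorem extendsOverBall_ite_bottom {P G : V × ℝ → T}
    (hP : ContinuousOn P (closedBall 0 1 ×ˢ Icc 0 1))
    (hG : ContinuousOn G (closedBall 0 1 ×ˢ Icc (-1) 1))
    (P_one : ∀ x ∈ closedBall (0 : V) 1, P (x, 1) = G (x, -1))
    (P_eq : ∀ x ∈ sphere (0 : V) 1, ∀ t ∈ Icc (0 : ℝ) 1, P (x, t) = G (x, -t)) :
    ExtendsOverBall fun z : V × ℝ => if z.2 = -1 then P (z.1, 0) else G (z.1, (z.2 + 1) / 2) := by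
  let h : (V × ℝ) × ℝ → T := fun y =>
    if y.1.2 = -1 then P (y.1.1, y.2) else G (y.1.1, ((1 + y.2) * y.1.2 + 1 - y.2) / 2)
  have hh : ContinuousOn h (sphere 0 1 ×ˢ Icc 0 1) := by
    have isClosed_dom : IsClosed (sphere (0 : V × ℝ) 1 ×ˢ Icc (0 : ℝ) 1) :=
      isClosed_sphere.prod isClosed_Icc
    have continuous_base : Continuous fun y : (V × ℝ) × ℝ => y.1 := continuous_fst
    refine continuousOn_ite_bottom isClosed_dom continuous_base (fun y hy => hy.1)
      (hP.comp (by fun_prop) ?_) (hG.comp (by fun_prop) ?_) ?_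
    · exact fun y hy => ⟨(sphere_prod_subset hy.1).1, hy.2⟩
    · rintro ⟨⟨x, t⟩, s⟩ ⟨hz, hs⟩
      obtain ⟨hx, ht⟩ := sphere_prod_subset hz
      simp only [mem_Icc] at hs ht
      exact ⟨hx, by nlinarith, by nlinarith⟩
    · rintro ⟨⟨x, t⟩, s⟩ ⟨-, hs⟩ hx ht
      dsimp only at hs hx ht ⊢
      rw [P_eq x hx s hs, ht]
      congr 2
      ring
  refine .of_homotopic (by rwa [closedBall_prod_eq]) hh (fun z _ => ?_) fun z hz => ?_
  · simp only [h, add_zero, one_mul, sub_zero]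
  · dsimp only [h]
    split_ifs with ht
    · rw [P_one _ (sphere_prod_subset hz).1, ← ht]
    · rw [show ((1 + 1) * z.2 + 1 - 1) / 2 = z.2 by ring]

theorem exists_homotopy_const_of_joined {F : V → T} {t₀ : T}
    (hF : ContinuousOn F (closedBall 0 1)) (h : Joined (F 0) t₀) :
    ∃ p : V × ℝ → T, ContinuousOn p (closedBall 0 1 ×ˢ Icc 0 1) ∧
      (∀ x, p (x, 0) = F x) ∧ ∀ x, p (x, 1) = t₀ := by
  obtain ⟨γ⟩ := h
  refine ⟨fun z => if z.2 ≤ 1 / 2 then F ((1 - 2 * z.2) • z.1) else γ.extend (2 * z.2 - 1),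
    continuousOn_ite_le (isClosed_closedBall.prod isClosed_Icc) (by fun_prop) (by fun_prop)
      (hF.comp (by fun_prop) ?_) (by fun_prop) ?_, fun x => ?_, fun x => ?_⟩
  · rintro ⟨x, t⟩ ⟨⟨hx, ht⟩, h⟩
    simp only [mem_Icc, mem_ofPred_eq, mem_closedBall_zero_iff] at hx ht h ⊢
    rw [norm_smul, Real.norm_eq_abs, abs_of_nonneg (by linarith)]
    exact mul_le_one₀ (by linarith) (norm_nonneg x) hx
  · rintro ⟨x, t⟩ - h
    dsimp only at h ⊢
    norm_num [h]
  · norm_num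
  · norm_num

end Extension

theorem continuousOn_kmul {M : Type u} [TopologicalSpace M] [Monoid M] [ContinuousKMul M]
    {W : Type} [TopologicalSpace W] [T2Space W] {s : Set W} (hs : IsCompact s) {f g : W → M}
    (hf : ContinuousOn f s) (hg : ContinuousOn g s) : ContinuousOn (fun w => f w * g w) s := by
  have : CompactSpace s := isCompact_iff_compactSpace.1 hs
  rw [continuousOn_iff_continuous_domRestrict] at *
  exact (ContinuousKMul.continuous_mul_test (ULift.{u} s) (fun x => s.domRestrict f x.down)
    (fun x => s.domRestrict g x.down) (hf.comp continuous_uliftDown)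
    (hg.comp continuous_uliftDown)).comp continuous_uliftUp

/-- A topological monoid whose path components form a group. -/
def IsGrouplike (M : Type*) [TopologicalSpace M] [Monoid M] : Prop :=
  ∀ m : M, ∃ m', Joined (m * m') 1

section Grouplike

variable {M : Type u} [TopologicalSpace M] [Monoid M] [ContinuousKMul M]

theorem joined_mul {a b c d : M} (h : Joined a b) (h' : Joined c d) : Joined (a * c) (b * d) := by
  obtain ⟨p⟩ := h
  obtain ⟨q⟩ := h'
  refine ⟨⟨⟨fun t => p t * q t, continuousOn_univ.1 ?_⟩, ?_, ?_⟩⟩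
  · exact continuousOn_kmul isCompact_univ p.continuous.continuousOn q.continuous.continuousOn
  · simp only [p.source, q.source]
  · simp only [p.target, q.target]

theorem IsGrouplike.exists_inverse (hM : IsGrouplike M) (m : M) :
    ∃ b, Joined (m * b) 1 ∧ Joined (b * m) 1 := by
  obtain ⟨b, hb⟩ := hM m
  obtain ⟨c, hc⟩ := hM b
  have h₁ : Joined (b * m * (b * c)) (b * m * 1) := joined_mul (Joined.refl _) hc
  have h₂ : Joined (b * ((m * b) * c)) (b * (1 * c)) :=
    joined_mul (Joined.refl _) (joined_mul hb (Joined.refl _))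
  have assoc : b * m * (b * c) = b * ((m * b) * c) := by simp only [mul_assoc]
  rw [mul_one, assoc] at h₁
  rw [one_mul] at h₂
  exact ⟨b, hb, h₁.symm.trans (h₂.trans hc)⟩

variable {V : Type} [NormedAddCommGroup V] [NormedSpace ℝ V] [ProperSpace V]

/-- If `δ` extends `b * ψ`, then `f * δ` extends `f * b * ψ`, which is homotopic to `ψ`. -/
theorem ExtendsOverBall.of_const_mul {f ψ : V → M} {b : M} (hf : ContinuousOn f (closedBall 0 1))
    (hb : Joined (f 0 * b) 1) (hψ : ContinuousOn ψ (sphere 0 1))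
    (h : ExtendsOverBall fun x => b * ψ x) : ExtendsOverBall ψ := by
  obtain ⟨δ, hδ, δ_eq⟩ := h
  have cB : IsCompact (closedBall (0 : V) 1) := isCompact_closedBall 0 1
  obtain ⟨p, hp, p₀, p₁⟩ :=
    exists_homotopy_const_of_joined (continuousOn_kmul cB hf (continuousOn_const (c := b))) hb
  refine of_homotopic (h := fun z => p (z.1, 1 - z.2) * ψ z.1) (continuousOn_kmul cB hf hδ)
    (continuousOn_kmul ((isCompact_sphere 0 1).prod isCompact_Icc)
      (hp.comp (by fun_prop) ?_) (hψ.comp continuousOn_fst fun z hz => hz.1))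
    (fun x _ => ?_) fun x hx => ?_
  · exact fun z hz =>
      ⟨sphere_subset_closedBall hz.1, by linarith [hz.2.2], by linarith [hz.2.1]⟩
  · rw [sub_zero, p₁, one_mul]
  · rw [sub_self, p₀, δ_eq hx, mul_assoc]

/-- Extend `b * K` below its bottom by a homotopy prescribed by the path from `b * f` to `1`, and
take for `g'` the bottom of the outcome `G`. What is to be extended is homotopic to `G` once it is
multiplied by `b`. -/
theorem IsGrouplike.exists_extendsOverBall (hM : IsGrouplike M) {f g : V → M} {K : V × ℝ → M}
    (hf : ContinuousOn f (closedBall 0 1)) (hg : ContinuousOn g (sphere 0 1))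
    (hK : ContinuousOn K (closedBall 0 1 ×ˢ Icc (-1) 1))
    (K₀ : ∀ x ∈ sphere (0 : V) 1, K (x, -1) = f x * g x) :
    ∃ g' : V → M, ContinuousOn g' (closedBall 0 1) ∧ EqOn g' g (sphere 0 1) ∧
      ExtendsOverBall fun z : V × ℝ => if z.2 = -1 then f z.1 * g' z.1 else K z := by
  have cB : IsCompact (closedBall (0 : V) 1) := isCompact_closedBall 0 1
  have cP : IsCompact (closedBall (0 : V) 1 ×ˢ Icc (-1 : ℝ) 1) := cB.prod isCompact_Icc
  have bottom_mem : (-1 : ℝ) ∈ Icc (-1 : ℝ) 1 := left_mem_Icc.2 (by norm_num)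
  obtain ⟨b, hb, hb'⟩ := hM.exists_inverse (f 0)
  obtain ⟨q, hq, q₀, q₁⟩ :=
    exists_homotopy_const_of_joined (continuousOn_kmul cB (continuousOn_const (c := b)) hf) hb'
  obtain ⟨G, hG, G_eq, G_neg⟩ := exists_extension_below (L := fun z => b * K z)
    (h := fun z => q z * g z.1) (continuousOn_kmul cP continuousOn_const hK)
    (continuousOn_kmul ((isCompact_sphere 0 1).prod isCompact_Icc)
      (hq.mono (prod_mono sphere_subset_closedBall subset_rfl))
      (hg.comp continuousOn_fst fun z hz => hz.1))
    (fun x hx => by rw [q₀, mul_assoc, K₀ x hx])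
  have hg' : ContinuousOn (fun x => G (x, -1)) (closedBall 0 1) :=
    hG.comp (by fun_prop) fun x hx => ⟨hx, bottom_mem⟩
  have g'_eq : ∀ x ∈ sphere (0 : V) 1, G (x, -1) = g x := fun x hx => by
    rw [G_neg x hx 1 (right_mem_Icc.2 zero_le_one), q₁, one_mul]
  have hfg' : ContinuousOn (fun x => f x * G (x, -1)) (closedBall 0 1) :=
    continuousOn_kmul cB hf hg'
  refine ⟨fun x => G (x, -1), hg', g'_eq, .of_const_mul (f := fun z => f z.1) (b := b)
    (hf.comp (f := Prod.fst) continuousOn_fst fun z hz => (closedBall_prod_eq.subset hz).1) hb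
    (continuousOn_ite_bottom isClosed_sphere continuous_id (fun _ hz => hz)
      (hfg'.comp continuousOn_fst fun z hz => (sphere_prod_subset hz).1)
      (hK.mono sphere_prod_subset) fun z _ hz hz' => ?_) ?_⟩
  · change f z.1 * G (z.1, -1) = K (z.1, z.2)
    rw [g'_eq z.1 hz, ← K₀ z.1 hz]
    exact congrArg (fun t => K (z.1, t)) hz'.symm
  · obtain ⟨Ψ, hΨ, Ψ_eq⟩ := extendsOverBall_ite_bottom (P := fun z => q z * G (z.1, -1))
      (continuousOn_kmul (cB.prod isCompact_Icc) hq
        (hg'.comp continuousOn_fst fun z hz => hz.1)) hG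
      (fun x _ => by rw [q₁, one_mul])
      (fun x hx t ht => by rw [g'_eq x hx, G_neg x hx t ht])
    refine ⟨Ψ, hΨ, fun z hz => (Ψ_eq hz).trans ?_⟩
    have hz' := sphere_prod_subset hz
    dsimp only
    split_ifs
    · rw [q₀, mul_assoc]
    · exact G_eq z.1 hz'.1 z.2 hz'.2

theorem IsGrouplike.exists_extension (hM : IsGrouplike M) {f g : V → M} {H : V × ℝ → M}
    (hf : ContinuousOn f (closedBall 0 1)) (hg : ContinuousOn g (sphere 0 1))
    (hH : ContinuousOn H (sphere 0 1 ×ˢ Icc (-1) 1))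
    (H₀ : ∀ x ∈ sphere (0 : V) 1, H (x, -1) = f x * g x)
    (H₁ : ∀ x ∈ sphere (0 : V) 1, H (x, 1) = 1) :
    ∃ (g' : V → M) (Γ : V × ℝ → M), ContinuousOn g' (closedBall 0 1) ∧
      ContinuousOn Γ (closedBall 0 1 ×ˢ Icc (-1) 1) ∧ EqOn g' g (sphere 0 1) ∧
      EqOn Γ H (sphere 0 1 ×ˢ Icc (-1) 1) ∧
      (∀ x ∈ closedBall (0 : V) 1, Γ (x, -1) = f x * g' x) ∧
      ∀ x ∈ closedBall (0 : V) 1, Γ (x, 1) = 1 := by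
  obtain ⟨K, hK, K_eq, K₁⟩ := exists_extension_of_top hH H₁
  obtain ⟨g', hg', g'_eq, Γ, hΓ, Γ_eq⟩ := hM.exists_extendsOverBall hf hg hK fun x hx =>
    (K_eq ⟨hx, left_mem_Icc.2 (by norm_num)⟩).trans (H₀ x hx)
  refine ⟨g', Γ, hg', by rwa [← closedBall_prod_eq], g'_eq, ?_, fun x hx => ?_, fun x hx => ?_⟩
  · rintro ⟨x, t⟩ ⟨hx, ht⟩
    rw [Γ_eq (mem_sphere_prod_iff.2 (Or.inl ⟨hx, ht⟩))]
    dsimp only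
    split_ifs with ht'
    · rw [g'_eq hx, ← H₀ x hx, ← ht']
    · exact K_eq ⟨hx, ht⟩
  · rw [Γ_eq (mem_sphere_prod_iff.2 (Or.inr ⟨hx, Or.inl rfl⟩))]
    exact if_pos rfl
  · rw [Γ_eq (mem_sphere_prod_iff.2 (Or.inr ⟨hx, Or.inr rfl⟩))]
    exact (if_neg (by norm_num)).trans (K₁ x hx)

end Grouplike

end Ball

section Cells

open Metric Set Topology.RelCWComplex

theorem exists_continuousOn_curry {Y T : Type*} [TopologicalSpace Y] [TopologicalSpace T]
    {s : Set Y} {Γ : Y × ℝ → T}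
    (hΓ : ContinuousOn Γ (s ×ˢ Icc (-1) 1)) :
    ∃ γ : Y → C(I, T), ContinuousOn γ s ∧ ∀ y ∈ s, ∀ t : I, γ y t = Γ (y, 2 * t - 1) := by
  have mem_Icc (t : I) : 2 * (t : ℝ) - 1 ∈ Icc (-1 : ℝ) 1 :=
    ⟨by linarith [t.2.1], by linarith [t.2.2]⟩
  have h : Continuous fun p : s × I => Γ (p.1, 2 * p.2 - 1) :=
    hΓ.comp_continuous (f := fun p : s × I => ((p.1 : Y), 2 * (p.2 : ℝ) - 1)) (by fun_prop)
      fun p => ⟨p.1.2, mem_Icc p.2⟩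
  let γ : C(s, C(I, T)) := ContinuousMap.curry ⟨_, h⟩
  have extend_eq (y : s) : Function.extend Subtype.val γ (fun y => .const I (Γ (y, 0))) y = γ y :=
    Subtype.val_injective.extend_apply ..
  refine ⟨Function.extend Subtype.val γ fun y => .const I (Γ (y, 0)), ?_, fun y hy t => ?_⟩
  · rw [continuousOn_iff_continuous_domRestrict]
    exact γ.continuous.congr fun y => (extend_eq y).symm
  · rw [extend_eq ⟨y, hy⟩]
    rfl

theorem continuousOn_image_of_comp {Y Z T : Type*} [TopologicalSpace Y] [TopologicalSpace Z]
    [T2Space Z] [TopologicalSpace T] {s : Set Y} (hs : IsCompact s) {φ : Y → Z}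
    (hφ : ContinuousOn φ s) {F : Z → T} (hF : ContinuousOn (F ∘ φ) s) :
    ContinuousOn F (φ '' s) := by
  rw [continuousOn_iff_isClosed]
  intro A hA
  obtain ⟨B, hB, hBs⟩ := (continuousOn_iff_isClosed.1 hF) A hA
  refine ⟨φ '' (B ∩ s),
    ((hs.inter_left hB).image_of_continuousOn (hφ.mono inter_subset_right)).isClosed, ?_⟩
  rw [← hBs]
  ext z
  constructor
  · rintro ⟨hz, y, hy, rfl⟩
    exact ⟨⟨y, ⟨hz, hy⟩, rfl⟩, y, hy, rfl⟩
  · rintro ⟨⟨y, ⟨hy, _⟩, rfl⟩, hz⟩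
    exact ⟨hy, hz⟩

variable {K T : Type*} [TopologicalSpace K] {C : Set K} [CWComplex C]

theorem exists_eqOn_skeletonLT_of_sphere [T2Space K] {m : ℕ} (s : K → T)
    (τ : cell C m → (Fin m → ℝ) → T)
    (hτ : ∀ e, EqOn (τ e) (s ∘ map m e) (sphere 0 1)) :
    ∃ s' : K → T, EqOn s' s (skeletonLT C m) ∧
      ∀ e, EqOn (s' ∘ map m e) (τ e) (closedBall 0 1) := by
  classical
  let s' : K → T := fun x => if hx : ∃ e : cell C m, x ∈ openCell m e then
    τ hx.choose ((map m hx.choose).symm x) else s x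
  have eq_low : EqOn s' s (skeletonLT C m) := fun x hx =>
    dif_neg fun ⟨_, he⟩ => disjoint_left.1 (disjoint_skeletonLT_openCell le_rfl) hx he
  refine ⟨s', eq_low, fun e y hy => ?_⟩
  rcases (mem_closedBall.1 hy).lt_or_eq with hy | hy
  · have mem_openCell : map m e y ∈ openCell m e := mem_image_of_mem _ hy
    have hx : ∃ e' : cell C m, map m e y ∈ openCell m e' := ⟨e, mem_openCell⟩
    have choose_eq : hx.choose = e := by
      by_contra hne
      exact disjoint_left.1 (disjoint_openCell_of_ne (C := C) (i := hx.choose) (j := e)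
        (by simpa using hne)) hx.choose_spec mem_openCell
    have symm_eq : (map m e).symm (map m e y) = y :=
      (map m e).left_inv (by rw [source_eq]; exact hy)
    refine (dif_pos hx).trans ?_
    rw [choose_eq, symm_eq]
  · exact (eq_low (cellFrontier_subset_skeletonLT m e (mem_image_of_mem _ hy))).trans (hτ e hy).symm

variable [TopologicalSpace T]

/-- Sections of `R` over the boundary of a cell extend over the cell. -/
def ExtendsSections (C : Set K) [CWComplex C] (R : K → T → Prop) : Prop :=
  ∀ (m : ℕ) (e : cell C m) (τ : (Fin m → ℝ) → T), ContinuousOn τ (sphere 0 1) →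
    (∀ y ∈ sphere 0 1, R (map m e y) (τ y)) →
      ∃ τ' : (Fin m → ℝ) → T, ContinuousOn τ' (closedBall 0 1) ∧ EqOn τ' τ (sphere 0 1) ∧
        ∀ y ∈ closedBall 0 1, R (map m e y) (τ' y)

theorem IsGrouplike.extendsSections {M : Type u} [TopologicalSpace M] [Monoid M]
    [ContinuousKMul M] (hM : IsGrouplike M) {f : K → M} (hf : ContinuousOn f C) :
    ExtendsSections C fun x (p : M × C(I, M)) => p.2 0 = f x * p.1 ∧ p.2 1 = 1 := by
  intro m e τ hτ hτR
  have hfe : ContinuousOn (f ∘ map m e) (closedBall 0 1) :=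
    hf.comp (RelCWComplex.continuousOn m e) fun y hy =>
      closedCell_subset_complex m e (mem_image_of_mem _ hy)
  let clamp (t : ℝ) : I := projIcc 0 1 zero_le_one ((1 + t) / 2)
  have clamp_neg_one : clamp (-1) = 0 := projIcc_of_le_left _ (by norm_num)
  have clamp_one : clamp 1 = 1 := projIcc_of_right_le _ (by norm_num)
  have continuous_clamp : Continuous clamp := continuous_projIcc.comp (by fun_prop)
  have hH : ContinuousOn (fun z : (Fin m → ℝ) × ℝ => (τ z.1).2 (clamp z.2))
      (sphere 0 1 ×ˢ Icc (-1) 1) :=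
    ContinuousEval.continuous_eval.comp_continuousOn ((hτ.snd.comp continuousOn_fst
      fun z hz => hz.1).prodMk (continuous_clamp.comp continuous_snd).continuousOn)
  obtain ⟨g, Γ, hg, hΓ, g_eq, Γ_eq, Γ₀, Γ₁⟩ := hM.exists_extension hfe hτ.fst hH
    (fun y hy => clamp_neg_one ▸ (hτR y hy).1) fun y hy => clamp_one ▸ (hτR y hy).2
  obtain ⟨γ, hγ, γ_eq⟩ := exists_continuousOn_curry hΓ
  refine ⟨fun y => (g y, γ y), hg.prodMk hγ, fun y hy => Prod.ext (g_eq hy) ?_,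
    fun y hy => ⟨?_, ?_⟩⟩
  · ext t
    have clamp_eq : clamp (2 * t - 1) = t :=
      (congrArg (projIcc 0 1 _) (by ring)).trans (projIcc_val zero_le_one t)
    exact (γ_eq y (sphere_subset_closedBall hy) t).trans ((Γ_eq ⟨hy, mem_Icc.2
      ⟨by linarith [t.2.1], by linarith [t.2.2]⟩⟩).trans (congrArg (τ y).2 clamp_eq))
  · rw [γ_eq y hy, Icc.coe_zero, mul_zero, zero_sub]
    exact Γ₀ y hy
  · rw [γ_eq y hy, Icc.coe_one, mul_one, show (2 - 1 : ℝ) = 1 by norm_num]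
    exact Γ₁ y hy

variable [T2Space K]

theorem continuousOn_of_closedCell {F : K → T}
    (hF : ∀ n (e : cell C n), ContinuousOn F (closedCell n e)) : ContinuousOn F C := by
  rw [continuousOn_iff_isClosed]
  intro A hA
  refine ⟨F ⁻¹' A ∩ C, ?_, by rw [inter_assoc, inter_self]⟩
  rw [CWComplex.closed C _ inter_subset_right]
  intro n e
  rw [inter_assoc, inter_eq_self_of_subset_right (closedCell_subset_complex n e), inter_comm]
  exact (hF n e).preimage_isClosed_of_isClosed isClosed_closedCell hA

theorem continuousOn_skeletonLT_succ {F : K → T} {m : ℕ} (hF : ContinuousOn F (skeletonLT C m))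
    (hF' : ∀ e : cell C m, ContinuousOn F (closedCell m e)) :
    ContinuousOn F (skeletonLT C (m + 1 : ℕ)) := by
  refine continuousOn_of_closedCell (C := (skeletonLT C (m + 1 : ℕ) : Set K)) fun n e => ?_
  obtain ⟨e, he⟩ := e
  rw [skeletonLT_I] at he
  have he : (n : ℕ∞) < (m + 1 : ℕ) := he
  rcases (Nat.lt_succ_iff.1 (Nat.cast_lt.1 he)).lt_or_eq with hn | rfl
  · exact hF.mono ((closedCell_subset_skeletonLT n e).trans
      (skeletonLT_mono (Nat.cast_le.2 (Nat.succ_le_of_lt hn))))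
  · exact hF' e

variable {R : K → T → Prop}

/-- A section of the relation `R` over the skeleton of dimension less than `m`. -/
def IsSectionOnSkeletonLT (C : Set K) [CWComplex C] (R : K → T → Prop) (m : ℕ) (s : K → T) : Prop :=
  ContinuousOn s (skeletonLT C m) ∧ ∀ x ∈ skeletonLT C m, R x (s x)

theorem IsSectionOnSkeletonLT.exists_succ (hR : ExtendsSections C R) {m : ℕ} {s : K → T}
    (hs : IsSectionOnSkeletonLT C R m s) :
    ∃ s', IsSectionOnSkeletonLT C R (m + 1) s' ∧ EqOn s' s (skeletonLT C m) := by
  have mapsTo_frontier (e : cell C m) : MapsTo (map m e) (sphere 0 1) (skeletonLT C m) :=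
    fun y hy => cellFrontier_subset_skeletonLT m e (mem_image_of_mem _ hy)
  have continuousOn_map (e : cell C m) := RelCWComplex.continuousOn m e
  choose τ hτ τ_eq hτR using fun e : cell C m => hR m e (s ∘ map m e)
    (hs.1.comp ((continuousOn_map e).mono sphere_subset_closedBall) (mapsTo_frontier e))
    fun y hy => hs.2 _ (mapsTo_frontier e hy)
  obtain ⟨s', s'_eq, s'_map⟩ := exists_eqOn_skeletonLT_of_sphere s τ τ_eq
  refine ⟨s', ⟨continuousOn_skeletonLT_succ (hs.1.congr s'_eq) fun e => ?_, fun x hx => ?_⟩, s'_eq⟩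
  · exact continuousOn_image_of_comp (isCompact_closedBall _ _) (continuousOn_map e)
      ((hτ e).congr (s'_map e))
  · have hx : x ∈ (skeletonLT C m : Set K) ∪ ⋃ e : cell C m, closedCell m e :=
      (skeletonLT_union_iUnion_closedCell_eq_skeletonLT_succ m).superset hx
    rcases hx with hx | hx
    · rw [s'_eq hx]
      exact hs.2 x hx
    · obtain ⟨e, y, hy, rfl⟩ := mem_iUnion.1 hx
      rw [show s' (map m e y) = τ e y from s'_map e hy]
      exact hτR e y hy

theorem ExtendsSections.exists_continuousOn [Nonempty T] (hR : ExtendsSections C R) :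
    ∃ F : K → T, ContinuousOn F C ∧ ∀ x ∈ C, R x (F x) := by
  have base : IsSectionOnSkeletonLT C R 0 fun _ => Classical.arbitrary T :=
    ⟨continuousOn_const, fun x hx =>
      absurd (CWComplex.skeletonLT_zero_eq_empty.subset hx) (notMem_empty x)⟩
  choose! next next_section next_eq using fun m s (hs : IsSectionOnSkeletonLT C R m s) =>
    hs.exists_succ hR
  let s : ℕ → K → T := fun m => Nat.rec (fun _ => Classical.arbitrary T) (fun m s => next m s) m
  have hs : ∀ m, IsSectionOnSkeletonLT C R m (s m) := fun m => by
    induction m with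
    | zero => exact base
    | succ m ih => exact next_section m (s m) ih
  have s_eq : ∀ {m l}, m ≤ l → EqOn (s l) (s m) (skeletonLT C m) := fun {m l} hml => by
    induction l, hml using Nat.le_induction with
    | base => exact eqOn_refl _ _
    | succ l hml ih =>
      exact ((next_eq l (s l) (hs l)).mono (skeletonLT_mono (Nat.cast_le.2 hml))).trans ih
  have mem_skeletonLT : ∀ x ∈ C, ∃ n : ℕ, x ∈ skeletonLT C n := fun x hx =>
    mem_iUnion.1 (iUnion_skeletonLT_eq_complex.superset hx)
  choose! N hN using mem_skeletonLT
  have F_eq : ∀ m, EqOn (fun x => s (N x) x) (s m) (skeletonLT C m) := fun m x hx =>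
    (s_eq (le_max_left _ _) (hN x ((skeletonLT C m).subset_complex hx))).symm.trans
      (s_eq (le_max_right _ _) hx)
  refine ⟨fun x => s (N x) x, continuousOn_of_closedCell fun n e => ?_,
    fun x hx => (hs (N x)).2 x (hN x hx)⟩
  exact ((hs (n + 1)).1.congr (F_eq _)).mono (closedCell_subset_skeletonLT n e)

/-- The pairs of a point `c` and a path from `f x * c` to `1` are the values at `x` of the right
inverses of `f` up to homotopy. -/
theorem exists_rightInverse_of_cwComplex {K : Type*} [TopologicalSpace K] [T2Space K]
    [CWComplex (univ : Set K)] {M : Type u} [TopologicalSpace M] [Monoid M] [ContinuousKMul M]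
    (hM : IsGrouplike M) (f : C(K, M)) :
    ∃ (g : C(K, M)) (h : C(K, C(I, M))), ∀ x, h x 0 = f x * g x ∧ h x 1 = 1 := by
  obtain ⟨F, hF, hFR⟩ :=
    (hM.extendsSections (C := univ) f.continuous.continuousOn).exists_continuousOn
  rw [continuousOn_univ] at hF
  exact ⟨⟨_, hF.fst⟩, ⟨_, hF.snd⟩, fun x => hFR x (mem_univ x)⟩

end Cells

section MapK

theorem isGrouplike_of_surjective {M N : Type*} [TopologicalSpace M] [Monoid M]
    [TopologicalSpace N] [Monoid N] (hM : IsGrouplike M) (φ : M →* N) (hφ : Continuous φ)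
    (hφ' : Function.Surjective φ) : IsGrouplike N := fun n => by
  obtain ⟨m, rfl⟩ := hφ' n
  obtain ⟨m', ⟨γ⟩⟩ := hM m
  refine ⟨φ m', ?_⟩
  rw [← map_mul, ← map_one φ]
  exact ⟨γ.map hφ⟩

instance locallyCompactSpace_compHaus (L : CompHaus.{u}) : LocallyCompactSpace L :=
  have (K : Type u) [TopologicalSpace K] [CompactSpace K] [T2Space K] : LocallyCompactSpace K :=
    inferInstance
  this L

/-- The mapping space adjoint to the compactly generated product with `Z`: the continuous maps from
`Z` to `M`, with the coarsest topology for which the restrictions along maps from compact Hausdorff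
spaces to `Z` are continuous for the compact-open topology. -/
def MapK (Z M : Type u) [TopologicalSpace Z] [TopologicalSpace M] : Type u := C(Z, M)

namespace MapK

variable {Z M : Type u} [TopologicalSpace Z] [TopologicalSpace M]

instance : TopologicalSpace (MapK Z M) :=
  ⨅ (L : CompHaus.{u}) (a : C(L, Z)),
    TopologicalSpace.induced (fun f : C(Z, M) => (f.comp a : C(L, M))) inferInstance

instance : CoeFun (MapK Z M) fun _ => Z → M := ⟨fun f z => ContinuousMap.toFun f z⟩

theorem continuous_iff {Y : Type*} [TopologicalSpace Y] {φ : Y → MapK Z M} :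
    Continuous φ ↔ ∀ (L : CompHaus.{u}) (a : C(L, Z)),
      Continuous fun p : Y × L => φ p.1 (a p.2) := by
  rw [continuous_iInf_rng]
  refine forall_congr' fun L => ?_
  rw [continuous_iInf_rng]
  refine forall_congr' fun a => ?_
  rw [continuous_induced_rng]
  exact ⟨fun h => ContinuousMap.continuous_uncurry_of_continuous ⟨_, h⟩,
    fun h => ContinuousMap.continuous_of_continuous_uncurry _ h⟩

theorem continuous_apply_apply {Y X : Type u} [TopologicalSpace Y] [TopologicalSpace X]
    {ψ : Y → MapK X (MapK Z M)} (hψ : Continuous ψ) {L : CompHaus.{u}} (a : C(L, X))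
    (b : C(L, Z)) : Continuous fun p : Y × L => ψ p.1 (a p.2) (b p.2) :=
  (continuous_iff.1 (continuous_iff.1 hψ L a) L b).comp (continuous_id.prodMk continuous_snd)

variable [IsGeneratedBy compHausFamily.{u} Z]

theorem joined_iff_homotopic {f g : MapK Z M} :
    Joined f g ↔ ContinuousMap.Homotopic f g := by
  constructor
  · rintro ⟨γ⟩
    have h : Continuous fun p : Z × I => γ p.2 p.1 := continuous_prod_of_test _ fun L a =>
      (continuous_iff.1 γ.continuous L a).comp continuous_swap
    exact ⟨⟨⟨fun p => γ p.1 p.2, h.comp continuous_swap⟩,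
      fun z => congrArg (fun f : MapK Z M => f z) γ.source,
      fun z => congrArg (fun f : MapK Z M => f z) γ.target⟩⟩
  · rintro ⟨F⟩
    exact ⟨⟨⟨fun t => F.curry t, continuous_iff.2 fun L a => F.continuous.comp
      (continuous_fst.prodMk (a.continuous.comp continuous_snd))⟩,
      ContinuousMap.ext F.apply_zero, ContinuousMap.ext F.apply_one⟩⟩

variable [Monoid M] [ContinuousKMul M]

instance : Monoid (MapK Z M) where
  mul f g := ⟨fun z => f z * g z, continuous_kmul (ContinuousMap.continuous f)
    (ContinuousMap.continuous g)⟩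
  one := ContinuousMap.const Z 1
  mul_assoc f g h := ContinuousMap.ext fun z => mul_assoc (f z) (g z) (h z)
  one_mul f := ContinuousMap.ext fun z => one_mul (f z)
  mul_one f := ContinuousMap.ext fun z => mul_one (f z)

instance : ContinuousKMul (MapK Z M) where
  continuous_mul_test K _ _ _ f g hf hg := by
    rw [continuous_iff] at *
    intro L a
    exact ContinuousKMul.continuous_mul_test (K × L) _ _ (hf L a) (hg L a)

/-- The constant maps, as a homomorphism to the mapping monoid. -/
def const (Z M : Type u) [TopologicalSpace Z] [IsGeneratedBy compHausFamily.{u} Z]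
    [TopologicalSpace M] [Monoid M] [ContinuousKMul M] : M →* MapK Z M where
  toFun m := ContinuousMap.const Z m
  map_one' := rfl
  map_mul' _ _ := rfl

theorem continuous_const : Continuous (const Z M) :=
  continuous_iff.2 fun _ _ => continuous_fst

theorem const_surjective [Unique Z] : Function.Surjective (const Z M) := fun f =>
  ⟨f default, ContinuousMap.ext fun z => congrArg _ (Subsingleton.elim default z)⟩

end MapK

theorem isGrouplike_mapK_of_hasCWHomotopyType {X : Type u} [TopologicalSpace X]
    [IsGeneratedBy compHausFamily.{u} X] (hX : HasCWHomotopyType X) {M : Type u}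
    [TopologicalSpace M] [Monoid M] [ContinuousKMul M] (hM : IsGrouplike M) :
    IsGrouplike (MapK X M) := fun f => by
  obtain ⟨K, _, _, ⟨_⟩, ⟨e⟩⟩ := hX
  let f : C(X, M) := f
  obtain ⟨g, h, hh⟩ := exists_rightInverse_of_cwComplex hM (f.comp e.invFun)
  let f' : MapK X M := f.comp (e.invFun.comp e.toFun)
  let g' : MapK X M := g.comp e.toFun
  have joined_f' : Joined (X := MapK X M) f f' :=
    MapK.joined_iff_homotopic.2 (.comp (.refl f) e.left_inv.symm)
  have joined_one : Joined (f' * g') 1 := MapK.joined_iff_homotopic.2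
    ⟨⟨⟨fun p => h (e p.2) p.1, by fun_prop⟩, fun x => (hh (e x)).1, fun x => (hh (e x)).2⟩⟩
  exact ⟨g', (joined_mul joined_f' (.refl g')).trans joined_one⟩

section Powers

variable {X : Type u} [TopologicalSpace X] {n : ℕ}

/-- The last `n` coordinates of a point of `X^(n + 1)`. -/
def KPow.tail : C(KPow X (n + 1), KPow X n) := KPow.reindex Fin.succ

instance : Unique (KPow X 0) := inferInstanceAs (Unique (Fin 0 → X))

variable [CompactlyGeneratedSpace X] {M : Type u} [TopologicalSpace M] [Monoid M]
  [ContinuousKMul M]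

/-- The maps from `X` to the mapping monoid of `X^n`, as maps on `X^(n + 1)`. -/
def MapK.uncurry (X : Type u) [TopologicalSpace X] [CompactlyGeneratedSpace X] (n : ℕ)
    (M : Type u) [TopologicalSpace M] [Monoid M] [ContinuousKMul M] :
    MapK X (MapK (KPow X n) M) →* MapK (KPow X (n + 1)) M where
  toFun ψ := {
    toFun v := ψ (v.coord 0) v.tail
    continuous_toFun := by
      rw [IsGeneratedBy.continuous_iff compHausFamily.{u}]
      intro L a
      have hψ : Continuous fun _ : PUnit => ψ := continuous_of_const fun _ _ => rfl
      exact (continuous_apply_apply hψ ((⟨_, KPow.continuous_coord_apply 0⟩ : C(_, X)).comp a)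
        (KPow.tail.comp a)).comp (Continuous.prodMk_right PUnit.unit) }
  map_one' := rfl
  map_mul' _ _ := rfl

theorem MapK.continuous_uncurry : Continuous (uncurry X n M) :=
  continuous_iff.2 fun _ a => continuous_apply_apply continuous_id
    ((⟨_, KPow.continuous_coord_apply 0⟩ : C(_, X)).comp a) (KPow.tail.comp a)

theorem MapK.uncurry_surjective : Function.Surjective (uncurry X n M) := fun f => by
  have continuous_cons (x : X) : Continuous fun v : KPow X n =>
      (KPow.mk (Fin.cons x v.coord) : KPow X (n + 1)) :=
    KPow.continuous_mk (_root_.continuous_const.finCons KPow.continuous_coord)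
  let ψ : X → MapK (KPow X n) M := fun x => ContinuousMap.comp f ⟨_, continuous_cons x⟩
  have hψ : Continuous ψ := continuous_iff.2 fun L a =>
    continuous_prod_of_test _ fun L' b =>
      (ContinuousMap.continuous f).comp (KPow.continuous_mk (W := L' × L)
        ((b.continuous.comp continuous_fst).finCons
          (KPow.continuous_coord.comp (a.continuous.comp continuous_snd))))
  refine ⟨(⟨ψ, hψ⟩ : C(X, _)), ContinuousMap.ext fun v => ?_⟩
  change f (KPow.mk (Fin.cons (v.coord 0) (Fin.tail v.coord))) = f v
  rw [Fin.cons_self_tail, KPow.mk_coord]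

theorem isGrouplike_mapK_kPow (hX : ∀ (M : Type u) [TopologicalSpace M] [Monoid M]
      [ContinuousKMul M], IsGrouplike M → IsGrouplike (MapK X M))
    (hM : IsGrouplike M) (n : ℕ) : IsGrouplike (MapK (KPow X n) M) := by
  induction n with
  | zero =>
    exact isGrouplike_of_surjective hM _ MapK.continuous_const MapK.const_surjective
  | succ n ih =>
    exact isGrouplike_of_surjective (hX _ ih) _ MapK.continuous_uncurry MapK.uncurry_surjective

end Powers

end MapK

section Invertibility

theorem isUnit_of_forall_exists_mul_eq_one {A : Type*} [Monoid A] (h : ∀ a : A, ∃ b, a * b = 1)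
    (a : A) : IsUnit a := by
  obtain ⟨b, hab⟩ := h a
  obtain ⟨c, hbc⟩ := h b
  have hac : a = c := left_inv_eq_right_inv hab hbc
  exact ⟨⟨a, b, hab, by rw [hac, hbc]⟩, rfl⟩

variable {X : Type u} [TopologicalSpace X]

theorem PowerClasses.exists_mul_eq_one {x₀ : X} (hx₀ : NondegenerateBasePoint x₀) {n : ℕ}
    {M : Type u} [TopologicalSpace M] [Monoid M] [ContinuousKMul M]
    (hM : IsGrouplike (MapK (KPow X n) M)) (a : PowerClasses x₀ n M) : ∃ b, a * b = 1 := by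
  obtain ⟨f⟩ := a
  obtain ⟨g, hg⟩ := hM f.1
  obtain ⟨D, hD⟩ := exists_nbhdRetract_base hx₀ n
  obtain ⟨F⟩ := MapK.joined_iff_homotopic.1 hg
  let A : (ContinuousMap.comp g D.r).Homotopy (.const _ 1) := {
    toFun p := F (p.1, D.r p.2)
    map_zero_left w := by
      refine (F.apply_zero (D.r w)).trans ?_
      change f.1 (D.r w) * g (D.r w) = g (D.r w)
      rw [hD, f.2, one_mul]
    map_one_left w := F.apply_one _ }
  obtain ⟨g', hgg', hg', -⟩ := D.exists_eq_on_range g A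
  have g'_base : g' (KPow.mk fun _ => x₀) = 1 := by
    rw [← hD (KPow.mk fun _ => x₀), hg']
  have joined_g : Joined (X := MapK (KPow X n) M) g' g :=
    MapK.joined_iff_homotopic.2 hgg'.symm
  have joined_one := (joined_mul (Joined.refl (X := MapK (KPow X n) M) f.1) joined_g).trans hg
  exact ⟨PointedClasses.mk ⟨g', g'_base⟩, PowerClasses.mk_eq_one_of_homotopic hx₀
    (f := f * (⟨g', g'_base⟩ : PointedMap _ M)) (MapK.joined_iff_homotopic.1 joined_one)⟩

theorem joined_smash_base [PathConnectedSpace X] (x₀ : X) {k : ℕ} (y : Smash x₀ k) :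
    Joined y (Smash.base x₀ k) := by
  obtain ⟨v⟩ := y
  let γ := fun i => (PathConnectedSpace.joined (v.coord i) x₀).somePath
  have : IsGeneratedBy compHausFamily.{u} (ULift.{u} I) := isGeneratedBy_of_compactlyGenerated _
  have h : Continuous fun t : ULift.{u} I => Smash.mk x₀ fun i => γ i t.down :=
    Smash.continuous_mk x₀ (continuous_pi fun i => (γ i).continuous.comp continuous_uliftDown)
  exact ⟨⟨⟨fun t => Smash.mk x₀ fun i => γ i t, h.comp continuous_uliftUp⟩,
    congrArg (Smash.mk x₀) (funext fun i => (γ i).source),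
    congrArg (Smash.mk x₀) (funext fun i => (γ i).target)⟩⟩

theorem James.joined_one {Y : Type u} [TopologicalSpace Y] [IsGeneratedBy compHausFamily.{u} Y]
    {y₀ : Y} (hY : ∀ y, Joined y y₀) (m : James y₀) : Joined m 1 := by
  have joined_letter (y : Y) : Joined (James.word y₀ [y]) 1 := by
    rw [← James.word_base y₀]
    exact (hY y).map (James.incl y₀).continuous
  obtain ⟨l, rfl⟩ : ∃ l, James.word y₀ l = m := by
    obtain ⟨l⟩ := m
    exact ⟨l.toList, rfl⟩
  induction l with
  | nil => exact Joined.refl _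
  | cons y l ih =>
    have h := joined_mul (joined_letter y) ih
    rwa [← James.word_append, mul_one] at h

theorem isUnit_cohenTarget [CompactlyGeneratedSpace X] [PathConnectedSpace X] {x₀ : X}
    (hx₀ : NondegenerateBasePoint x₀) (hX : HasCWHomotopyType X) {n k : ℕ}
    (a : CohenTarget x₀ n k) : IsUnit a := by
  have isGrouplike_james : IsGrouplike (James (Smash.base x₀ k)) := fun m =>
    ⟨1, by rw [mul_one]; exact James.joined_one (joined_smash_base x₀) m⟩
  exact isUnit_of_forall_exists_mul_eq_one (PowerClasses.exists_mul_eq_one hx₀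
    (isGrouplike_mapK_kPow (fun _ => isGrouplike_mapK_of_hasCWHomotopyType hX)
      isGrouplike_james n)) a

end Invertibility

end CohenJames

theorem proposition2p5 {X : Type u} [TopologicalSpace X] [CompactlyGeneratedSpace X]
    [PathConnectedSpace X] (x₀ : X) (hx₀ : CohenJames.NondegenerateBasePoint x₀) (hcat : CohenJames.WeakLSCatLT x₀ 2)
    (n k : ℕ) (hk : 1 ≤ k) :
    (CohenJames.HasCWHomotopyType X → ∀ a : CohenJames.CohenTarget x₀ n k, IsUnit a) ∧
      ((∀ a : CohenJames.CohenTarget x₀ n k, IsUnit a) →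
        ∃ e : CohenJames.CohenGroup n k →* CohenJames.CohenTarget x₀ n k,
          ∀ i : Fin k → Fin n, e (PresentedGroup.of i) = CohenJames.wordClass x₀ i) :=
  ⟨fun hX a => CohenJames.isUnit_cohenTarget hx₀ hX a,
    fun h => CohenJames.exists_cohenGroup_hom hx₀ hcat hk fun _ => h _⟩
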